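/- **Model.** Let $\tau\in(0,1)$ and let $\mathcal T$ be a compact interval. Subjects $i=0,1,2,\dots$ have i.i.d. records $Z_i$, which determine the scalar response $Y_i$ and the square-integrable random curve $X_i=\{X_i(t):t\in\mathcal T\}$, with $\mu(t)=E\,X_i(t)$. There are $a\in\mathbb R$, $b\in L_2(\mathcal T)$ such that $Q_\tau(X_i)=a+\int_{\mathcal T}b(t)\{X_i(t)-\mu(t)\}dt$ and $\varepsilon_i=Y_i-Q_\tau(X_i)$ satisfy $P(\varepsilon_i\le 0\mid X_i)=\tau$ a.s. and $E|\varepsilon_i|<\infty$. The curves are observed only through $U_{il}=X_i(T_{il})+\epsilon_{il}$, $T_{il}\in\mathcal T$, $l=1,\dots,N_i$, where the $\epsilon_{il}$ are i.i.d. with mean zero and finite variance and are independent of the $X_i$ ($N_i$ and $T_{il}$ may depend on $n$); the subjects, with their records, sampling points and errors, are independent. The sample is $\mathcal D_n=\{(Y_i,T_{il},U_{il}):l\le N_i,\ 1\le i\le n\}$; subject $0$ is to be predicted. Let $\rho_\tau(e)=(\tau-\mathbf 1\{e\le0\})e$. **Estimators.** From a sample one computes estimators $\widehat\mu,\widehat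 G,\widehat\sigma_u^2$ of the mean function, covariance function and error variance (for example by local linear smoothing; any choice is allowed), with spectral decomposition $\widehat G(s,t)=\sum_{j\ge1}\widehat\kappa_j\widehat\phi_j(s)\widehat\phi_j(t)$, $\widehat\kappa_1\ge\widehat\kappa_2\ge\dots\ge0$, $\{\widehat\phi_j\}$ orthonormal. With $\mathbf U_i=(U_{il})_l$, $\widehat{\boldsymbol\mu}_i=(\widehat\mu(T_{il}))_l$, $\widehat{\boldsymbol\phi}_{ij}=(\widehat\phi_j(T_{il}))_l$ and $\widehat{\boldsymbol\Sigma}_i=\{\widehat G(T_{il},T_{il'})+\widehat\sigma_u^2\mathbf 1\{l=l'\}\}_{l,l'}$, put $\widehat\xi_{ij}=\widehat\kappa_j\widehat{\boldsymbol\phi}_{ij}^\top\widehat{\boldsymbol\Sigma}_i^{-1}(\mathbf U_i-\widehat{\boldsymbol\mu}_i)$ and $\widehat X_{i,J}(t)=\widehat\mu(t)+\sum_{j\le J}\widehat\xi_{ij}\widehat\phi_j(t)$. For each $J$ in a deterministic, finite, non-empty candidate set $\mathcal J=\mathcal J_n$, let $(\widehat a_J,\widehat b_{1,J},\dots,\widehat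 b_{J,J})$ minimise $\sum_i\rho_\tau(Y_i-a-\sum_{j\le J}b_j\widehat\xi_{ij})$, let $\widehat b_J=\sum_{j\le J}\widehat b_{j,J}\widehat\phi_j$ and $\widehat Q_{\tau,J}(X_i)=\widehat a_J+\int_{\mathcal T}\widehat b_J(t)\{\widehat X_{i,J}(t)-\widehat\mu(t)\}dt$. Let $\mathcal W$ be the simplex of weights $\mathbf w=(w_J)_{J\in\mathcal J}$, $w_J\ge0$, $\sum_Jw_J=1$, and $\widehat Q_\tau(X_i,\mathbf w)=\sum_Jw_J\widehat Q_{\tau,J}(X_i)$. Let $2\le K\le n$ ($K$ may depend on $n$), $M=\lfloor n/K\rfloor$, and for $k\le K$ let $\widehat a_J^{[-k]},\widehat b_J^{[-k]}$ be obtained by the same procedure from the sample without its subjects $(k-1)M+1,\dots,kM$; define $\widehat Q_\tau^{[-k]}(X_i,\mathbf w)$ like $\widehat Q_\tau(X_i,\mathbf w)$ with these, and with $\widehat X_{i,J},\widehat\mu$ from the whole sample. Let $\widehat{\mathbf w}$ be a minimiser over $\mathcal W$ of $$\mathrm{CV}_K(\mathbf w)=\frac1n\sum_{k=1}^K\sum_{m=1}^M\rho_\tau\bigl(Y_{(k-1)M+m}-\widehat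 Q_\tau^{[-k]}(X_{(k-1)M+m},\mathbf w)\bigr),$$ and let $\mathrm{EFPE}_n(\mathbf w)=E\{\rho_\tau(Y_0-\widehat Q_\tau(X_0,\mathbf w))\mid\mathcal D_n\}-E\{\rho_\tau(\varepsilon_0)\}$. **Conditions.** 1. There are constants $a_J^*$, functions $b_J^*$, curves $X_{i,J}^*$ (for each $J\in\mathcal J$ and $n$ the same measurable function of the record $Z_i$ for every $i$) and $c_n\ge0$, $c_n\to0$, such that $\widehat a_J-a_J^*$, $\widehat b_J(t)-b_J^*(t)$, $\widehat\mu(t)-\mu(t)$, $\widehat X_{i,J}(t)-X_{i,J}^*(t)$ and $E\{|\widehat X_{0,J}(t)-X_{0,J}^*(t)|\mid\mathcal D_n\}$ are $O_p(c_n)$ uniformly over $t\in\mathcal T$, $J\in\mathcal J$, $1\le i\le n$. Moreover $\sup_n\max_{J\in\mathcal J}\int_{\mathcal T}|b_J^*(t)|dt<\infty$ and $\sup_nE\max_{J\in\mathcal J}\int_{\mathcal T}|X_{0,J}^*(t)-\mu(t)|dt<\infty$. 2. With $Q_{\tau,J}^*(X_i)=a_J^*+\int_{\mathcal T}b_J^*(t)\{X_{i,J}^*(t)-\mu(t)\}dt$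 there is a constant $\varrho>0$ with $|Q_{\tau,J}^*(X_i)-Q_\tau(X_i)|\le\varrho$ a.s. for all $n$, $J\in\mathcal J$, $0\le i\le n$. 3. There is $g_n\ge0$, $g_n\to0$, with $\widehat Q_\tau(X_{(k-1)M+m},\mathbf w)-\widehat Q_\tau^{[-k]}(X_{(k-1)M+m},\mathbf w)=O_p(g_n)$ uniformly over $\mathbf w\in\mathcal W$, $k\le K$, $m\le M$. 4. Let $\eta_n=n\inf_{\mathbf w\in\mathcal W}\bigl[E\{\rho_\tau(Y_0-\sum_{J}w_JQ_{\tau,J}^*(X_0))\}-E\{\rho_\tau(\varepsilon_0)\}\bigr]$. Then $\eta_n>0$ for all large $n$, and $\eta_n^{-1}n^{1/2}|\mathcal J|^{1/2}$, $\eta_n^{-1}nc_n$, $\eta_n^{-1}ng_n$ tend to $0$. **Theorem.** Under these conditions, with probability tending to one $\mathrm{EFPE}_n(\mathbf w)$ is finite for all $\mathbf w\in\mathcal W$ and $\inf_{\mathbf w\in\mathcal W}\mathrm{EFPE}_n(\mathbf w)>0$, and $$\frac{\mathrm{EFPE}_n(\widehat{\mathbf w})}{\inf_{\mathbf w\in\mathcal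 W}\mathrm{EFPE}_n(\mathbf w)}=1+O_p\bigl\{\eta_n^{-1}n\bigl(c_n+g_n+n^{-1/2}|\mathcal J|^{1/2}\bigr)\bigr\}=1+o_p(1).$$ -/

import Mathlib

open MeasureTheory ProbabilityTheory Set Filter Topology
open scoped ENNReal Matrix

noncomputable section

namespace FLQR

/-! ### Data and estimators -/

/-- The check function `ρ_τ(e) = (τ - 1{e ≤ 0}) e`. -/
def check (τ e : ℝ) : ℝ := (τ - if e ≤ 0 then 1 else 0) * e

/-- A discretely observed noisy curve: `N` sampling points `T l` with noisy values `U l`. -/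
structure CurveObs where
  N : ℕ
  T : Fin N → ℝ
  U : Fin N → ℝ

/-- An observed sample: the list of the pairs (response, discretely observed curve). -/
abbrev Sample := List (ℝ × CurveObs)

/-- The output of a functional principal component analysis on the interval `[α, β]`: estimates of
the mean function, of the covariance function and of the noise variance, together with the spectral
decomposition `cov s t = ∑ j, eigval j * eigfun j s * eigfun j t` of the estimated covariance. -/
structure FPCA (α β : ℝ) where
  mean : ℝ → ℝ
  cov : ℝ → ℝ → ℝ
  noiseVar : ℝ
  eigval : ℕ → ℝ
  eigfun : ℕ → ℝ → ℝ
  measurable_mean : Measurable mean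
  measurable_cov : Measurable (Function.uncurry cov)
  measurable_eigfun : ∀ j, Measurable (eigfun j)
  eigval_antitone : Antitone eigval
  eigval_nonneg : ∀ j, 0 ≤ eigval j
  orthonormal : ∀ j k, ∫ t in Icc α β, eigfun j t * eigfun k t = if j = k then 1 else 0
  spectral : ∀ s ∈ Icc α β, ∀ t ∈ Icc α β,
    HasSum (fun j => eigval j * eigfun j s * eigfun j t) (cov s t)

namespace FPCA

variable {α β : ℝ}

/-- The estimated covariance matrix of the noisy values of an observed curve. -/
def sigma (F : FPCA α β) (c : CurveObs) : Matrix (Fin c.N) (Fin c.N) ℝ :=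
  Matrix.of fun l l' => F.cov (c.T l) (c.T l') + if l = l' then F.noiseVar else 0

/-- The estimated score of an observed curve on component `j`, obtained by conditional expectation
(PACE): `κ_j φ_jᵀ Σ⁻¹ (U - μ)`. Components are numbered from `0`. -/
def score (F : FPCA α β) (c : CurveObs) (j : ℕ) : ℝ :=
  F.eigval j *
    ((fun l => F.eigfun j (c.T l)) ⬝ᵥ ((F.sigma c)⁻¹ *ᵥ fun l => c.U l - F.mean (c.T l)))

/-- The reconstruction of an observed curve from its first `J` components. -/
def curve (F : FPCA α β) (J : ℕ) (c : CurveObs) (t : ℝ) : ℝ :=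
  F.mean t + ∑ j ∈ Finset.range J, F.score c j * F.eigfun j t

end FPCA

/-- The quantile regression objective for the intercept `θ.1` and the coefficients `θ.2` of the
first `J` estimated scores. -/
def qrLoss {α β : ℝ} (τ : ℝ) (F : FPCA α β) (J : ℕ) (S : Sample) (θ : ℝ × (Fin J → ℝ)) : ℝ :=
  (S.map fun s => check τ (s.1 - θ.1 - ∑ j : Fin J, θ.2 j * F.score s.2 j)).sum

/-- An estimation procedure: it computes from every sample a functional principal component
analysis (by any smoother) and, for every `J`, a minimiser of the quantile regression objective. -/
structure Procedure (α β τ : ℝ) where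
  fpca : Sample → FPCA α β
  coef : (J : ℕ) → Sample → ℝ × (Fin J → ℝ)
  coef_min : ∀ (J : ℕ) (S : Sample) (θ : ℝ × (Fin J → ℝ)),
    qrLoss τ (fpca S) J S (coef J S) ≤ qrLoss τ (fpca S) J S θ

namespace Procedure

variable {α β τ : ℝ}

/-- Estimated intercept of the model with `J` components. -/
def intercept (A : Procedure α β τ) (J : ℕ) (S : Sample) : ℝ := (A.coef J S).1

/-- Estimated slope function of the model with `J` components. -/
def slope (A : Procedure α β τ) (J : ℕ) (S : Sample) (t : ℝ) : ℝ :=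
  ∑ j : Fin J, (A.coef J S).2 j * (A.fpca S).eigfun j t

/-- Prediction at the observed curve `c`: intercept and slope are computed from `S'`, the mean
function and the reconstructed curve from `S`. -/
def predictFrom (A : Procedure α β τ) (J : ℕ) (S' S : Sample) (c : CurveObs) : ℝ :=
  A.intercept J S' +
    ∫ t in Icc α β, A.slope J S' t * ((A.fpca S).curve J c t - (A.fpca S).mean t)

/-- The model averaging prediction based on the whole sample `S`. -/
def predictAvg (A : Procedure α β τ) {𝒥 : Finset ℕ} (w : 𝒥 → ℝ) (S : Sample) (c : CurveObs) : ℝ :=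
  ∑ J : 𝒥, w J * A.predictFrom J S S c

/-- The sample without its `k`-th group of size `M`; groups are numbered from `0`. -/
def leaveOut (M k : ℕ) (S : Sample) : Sample := S.take (k * M) ++ S.drop ((k + 1) * M)

/-- The model averaging prediction with the `k`-th group of size `M` left out. -/
def predictAvgOut (A : Procedure α β τ) {𝒥 : Finset ℕ} (w : 𝒥 → ℝ) (M k : ℕ) (S : Sample)
    (c : CurveObs) : ℝ :=
  ∑ J : 𝒥, w J * A.predictFrom J (leaveOut M k S) S c

end Procedure

/-! ### The population and the sampling scheme -/

/-- Subjects `i = 0, 1, 2, …`, subject `0` being the one to predict. Subject `i` has a record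
`Z i` which determines its response `y (Z i)` and its curve `x (Z i)`. At sample size `n` its curve
is observed at the points `T n i l`, `l < N n i`, with measurement errors `e i l`. The numbers
`a` and the function `b` are the intercept and the slope of the conditional `τ`-quantile. -/
structure Model (Ω E : Type*) where
  α : ℝ
  β : ℝ
  τ : ℝ
  Z : ℕ → Ω → E
  y : E → ℝ
  x : E → ℝ → ℝ
  N : ℕ → ℕ → Ω → ℕ
  T : ℕ → ℕ → ℕ → Ω → ℝ
  e : ℕ → ℕ → Ω → ℝ
  a : ℝ
  b : ℝ → ℝ

namespace Model

variable {Ω E : Type*} [MeasurableSpace Ω] [MeasurableSpace E]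

/-- The response of subject `i`. -/
def Y (D : Model Ω E) (i : ℕ) (ω : Ω) : ℝ := D.y (D.Z i ω)

/-- The curve of subject `i`. -/
def X (D : Model Ω E) (i : ℕ) (ω : Ω) (t : ℝ) : ℝ := D.x (D.Z i ω) t

/-- The mean function `μ(t) = E X(t)`. -/
def μ (D : Model Ω E) (P : Measure Ω) (t : ℝ) : ℝ := ∫ ω, D.X 0 ω t ∂P

/-- `Q_τ(X_i) = a + ∫ b(t) (X_i(t) - μ(t)) dt`. -/
def Q (D : Model Ω E) (P : Measure Ω) (i : ℕ) (ω : Ω) : ℝ :=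
  D.a + ∫ t in Icc D.α D.β, D.b t * (D.X i ω t - D.μ P t)

/-- The quantile regression error `ε_i = Y_i - Q_τ(X_i)`. -/
def err (D : Model Ω E) (P : Measure Ω) (i : ℕ) (ω : Ω) : ℝ := D.Y i ω - D.Q P i ω

/-- The curve of subject `i` as a random element of the space of functions on `[α, β]`. -/
def Xpath (D : Model Ω E) (i : ℕ) (ω : Ω) : Icc D.α D.β → ℝ := fun t => D.X i ω t

/-- What is observed of the curve of subject `i` at sample size `n`:
`U l = X_i(T l) + e i l`, `l < N`. -/
def obs (D : Model Ω E) (n i : ℕ) (ω : Ω) : CurveObs where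
  N := D.N n i ω
  T := fun l => D.T n i l ω
  U := fun l => D.X i ω (D.T n i l ω) + D.e i l ω

/-- The observed sample of size `n`, that is, subjects `1, …, n`. -/
def sample (D : Model Ω E) (n : ℕ) (ω : Ω) : Sample :=
  (List.range n).map fun i => (D.Y (i + 1) ω, D.obs n (i + 1) ω)

/-- The functional linear quantile regression model. -/
structure IsFLQR (D : Model Ω E) (P : Measure Ω) : Prop where
  interval : D.α < D.β
  level : D.τ ∈ Ioo (0 : ℝ) 1
  measurable_Z : ∀ i, Measurable (D.Z i)
  measurable_y : Measurable D.y
  measurable_x : Measurable (Function.uncurry D.x)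
  measurable_N : ∀ n i, Measurable (D.N n i)
  measurable_T : ∀ n i l, Measurable (D.T n i l)
  measurable_e : ∀ i l, Measurable (D.e i l)
  /-- the records are identically distributed -/
  ident : ∀ i, IdentDistrib (D.Z i) (D.Z 0) P P
  /-- the subjects, with their sampling points and measurement errors, are independent -/
  indep : ∀ n, iIndepFun
    (fun i ω => (D.Z i ω, D.N n i ω, (fun l => D.T n i l ω), (fun l => D.e i l ω))) P
  points_mem : ∀ n i ω, ∀ l < D.N n i ω, D.T n i l ω ∈ Icc D.α D.β
  /-- the measurement errors are i.i.d., centred, of finite variance, independent of the curves -/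
  noise_indep : iIndepFun (fun (p : ℕ × ℕ) ω => D.e p.1 p.2 ω) P
  noise_ident : ∀ i l, IdentDistrib (D.e i l) (D.e 0 0) P P
  noise_memLp : MemLp (D.e 0 0) 2 P
  noise_mean : ∫ ω, D.e 0 0 ω ∂P = 0
  noise_curve : ∀ i, IndepFun (D.Xpath i) (fun ω l => D.e i l ω) P
  /-- the curves are square integrable -/
  curve_memLp : ∀ t ∈ Icc D.α D.β, MemLp (fun ω => D.X 0 ω t) 2 P
  curve_memLp_prod : MemLp (fun p : Ω × ℝ => D.X 0 p.1 p.2) 2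
    (P.prod (volume.restrict (Icc D.α D.β)))
  slope_memLp : MemLp D.b 2 (volume.restrict (Icc D.α D.β))
  /-- `P(ε_i ≤ 0 | X_i) = τ` almost surely -/
  quantile : ∀ i, P[({ω | D.err P i ω ≤ 0}.indicator fun _ => (1 : ℝ)) |
    MeasurableSpace.comap (D.Xpath i) inferInstance] =ᵐ[P] fun _ => D.τ
  /-- `E ρ_τ(ε_0)` is finite -/
  err_integrable : Integrable (D.err P 0) P

end Model

/-! ### Stochastic order -/

/-- `Z n x = O_p(r n)` uniformly over `x ∈ I n`, that is, `sup_{x ∈ I n} Z n x = O_p(r n)`. For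
sets that are not measurable, `P` is the outer probability. -/
def UnifBigOp {Ω ι : Type*} [MeasurableSpace Ω] (P : Measure Ω) (I : ℕ → Set ι)
    (Z : ℕ → ι → Ω → ℝ≥0∞) (r : ℕ → ℝ) : Prop :=
  ∀ δ : ℝ, 0 < δ → ∃ C : ℝ, 0 < C ∧ ∀ᶠ n in atTop,
    P {ω | ∃ x ∈ I n, ENNReal.ofReal (C * r n) < Z n x ω} ≤ ENNReal.ofReal δ

/-! ### Prediction errors and the cross-validation weights -/

namespace Model

variable {Ω E : Type*} [MeasurableSpace Ω] [MeasurableSpace E]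

/-- The loss at the new subject (at outcome `ω'`) of the averaged prediction that is built from the
sample at outcome `ω`. -/
def newLoss (D : Model Ω E) (A : ℕ → Procedure D.α D.β D.τ) {𝒥 : ℕ → Finset ℕ} (n : ℕ) (ω : Ω)
    (w : 𝒥 n → ℝ) (ω' : Ω) : ℝ :=
  check D.τ (D.Y 0 ω' - (A n).predictAvg w (D.sample n ω) (D.obs n 0 ω'))

/-- `EFPE_n(w) = E{ρ_τ(Y_0 - Q̂_τ(X_0, w)) | D_n} - E ρ_τ(ε_0)`. As subject `0` is independent of the
sample, the conditional expectation given the sample is the integral over subject `0` with the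
sample held fixed. -/
def EFPE (D : Model Ω E) (P : Measure Ω) (A : ℕ → Procedure D.α D.β D.τ) {𝒥 : ℕ → Finset ℕ}
    (n : ℕ) (ω : Ω) (w : 𝒥 n → ℝ) : ℝ :=
  (∫ ω', D.newLoss A n ω w ω' ∂P) - ∫ ω', check D.τ (D.err P 0 ω') ∂P

/-- The infimum of the excess final prediction error over the weight simplex. -/
def infEFPE (D : Model Ω E) (P : Measure Ω) (A : ℕ → Procedure D.α D.β D.τ) (𝒥 : ℕ → Finset ℕ)
    (n : ℕ) (ω : Ω) : ℝ :=
  ⨅ w : stdSimplex ℝ (𝒥 n), D.EFPE P A n ω w.1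

/-- The `K`-fold cross-validation criterion, with groups of size `M = ⌊n / K⌋`. In-sample subject
`k * M + m + 1` is member `m` of group `k`. -/
def CV (D : Model Ω E) (A : ℕ → Procedure D.α D.β D.τ) {𝒥 : ℕ → Finset ℕ} (K : ℕ → ℕ)
    (n : ℕ) (ω : Ω) (w : 𝒥 n → ℝ) : ℝ :=
  (1 / (n : ℝ)) * ∑ k ∈ Finset.range (K n), ∑ m ∈ Finset.range (n / K n),
    check D.τ (D.Y (k * (n / K n) + m + 1) ω -
      (A n).predictAvgOut w (n / K n) k (D.sample n ω) (D.obs n (k * (n / K n) + m + 1) ω))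

/-- `w` minimises the cross-validation criterion over the weight simplex. -/
def IsCVWeight (D : Model Ω E) (A : ℕ → Procedure D.α D.β D.τ) {𝒥 : ℕ → Finset ℕ} (K : ℕ → ℕ)
    (n : ℕ) (ω : Ω) (w : 𝒥 n → ℝ) : Prop :=
  w ∈ stdSimplex ℝ (𝒥 n) ∧ ∀ v ∈ stdSimplex ℝ (𝒥 n), D.CV A K n ω w ≤ D.CV A K n ω v

end Model

/-! ### Limits of the estimators, and the conditions -/

/-- Candidate limits: intercepts `a n J`, slope functions `b n J` and curves. The limit curve of
subject `i` in model `J` is `x n J (Z i)`, the same function of the record for every subject. -/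
structure Limits (E : Type*) where
  a : ℕ → ℕ → ℝ
  b : ℕ → ℕ → ℝ → ℝ
  x : ℕ → ℕ → E → ℝ → ℝ

namespace Model

variable {Ω E : Type*} [MeasurableSpace Ω] [MeasurableSpace E]

/-- `Q*_{τ,J}(X_i) = a*_J + ∫ b*_J(t) (X*_{i,J}(t) - μ(t)) dt`. -/
def Qstar (D : Model Ω E) (P : Measure Ω) (L : Limits E) (n J i : ℕ) (ω : Ω) : ℝ :=
  L.a n J + ∫ t in Icc D.α D.β, L.b n J t * (L.x n J (D.Z i ω) t - D.μ P t)

/-- `EFPE*_n(w) = E ρ_τ(Y_0 - ∑_J w_J Q*_{τ,J}(X_0)) - E ρ_τ(ε_0)`. -/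
def EFPEstar (D : Model Ω E) (P : Measure Ω) (L : Limits E) {𝒥 : ℕ → Finset ℕ} (n : ℕ)
    (w : 𝒥 n → ℝ) : ℝ :=
  (∫ ω, check D.τ (D.Y 0 ω - ∑ J : 𝒥 n, w J * D.Qstar P L n J 0 ω) ∂P)
    - ∫ ω, check D.τ (D.err P 0 ω) ∂P

/-- `η_n = n inf_w EFPE*_n(w)`. -/
def η (D : Model Ω E) (P : Measure Ω) (L : Limits E) (𝒥 : ℕ → Finset ℕ) (n : ℕ) : ℝ :=
  n * ⨅ w : stdSimplex ℝ (𝒥 n), D.EFPEstar P L n w.1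

/-- The estimators converge to the limits `L` at the rate `c`, uniformly over `[α, β]`, over the
candidate models and over the sample; the limiting slopes are bounded in `L¹`, and the limiting
curves are bounded in mean, uniformly over the candidate models. -/
structure ConvergesTo (D : Model Ω E) (P : Measure Ω) (A : ℕ → Procedure D.α D.β D.τ)
    (𝒥 : ℕ → Finset ℕ) (L : Limits E) (c : ℕ → ℝ) : Prop where
  rate_nonneg : ∀ n, 0 ≤ c n
  rate_tendsto : Tendsto c atTop (𝓝 0)
  measurable_b : ∀ n, ∀ J ∈ 𝒥 n, Measurable (L.b n J)
  measurable_x : ∀ n, ∀ J ∈ 𝒥 n, Measurable (Function.uncurry (L.x n J))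
  intercept : UnifBigOp P (fun n => {J : ℕ | J ∈ 𝒥 n})
    (fun n J ω => ‖(A n).intercept J (D.sample n ω) - L.a n J‖ₑ) c
  slope : UnifBigOp P (fun n => {p : ℕ × ℝ | p.1 ∈ 𝒥 n ∧ p.2 ∈ Icc D.α D.β})
    (fun n p ω => ‖(A n).slope p.1 (D.sample n ω) p.2 - L.b n p.1 p.2‖ₑ) c
  mean : UnifBigOp P (fun _ => Icc D.α D.β)
    (fun n t ω => ‖((A n).fpca (D.sample n ω)).mean t - D.μ P t‖ₑ) c
  curve : UnifBigOp P
    (fun n => {p : ℕ × ℕ × ℝ | p.1 ∈ Icc 1 n ∧ p.2.1 ∈ 𝒥 n ∧ p.2.2 ∈ Icc D.α D.β})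
    (fun n p ω => ‖((A n).fpca (D.sample n ω)).curve p.2.1 (D.obs n p.1 ω) p.2.2
      - L.x n p.2.1 (D.Z p.1 ω) p.2.2‖ₑ) c
  /-- `E{|X̂_{0,J}(t) - X*_{0,J}(t)| | D_n} = O_p(c_n)` -/
  new_curve : UnifBigOp P (fun n => {p : ℕ × ℝ | p.1 ∈ 𝒥 n ∧ p.2 ∈ Icc D.α D.β})
    (fun n p ω => ∫⁻ ω', ‖((A n).fpca (D.sample n ω)).curve p.1 (D.obs n 0 ω') p.2
      - L.x n p.1 (D.Z 0 ω') p.2‖ₑ ∂P) c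
  bdd_b : ∃ B : ℝ, ∀ n, ∀ J ∈ 𝒥 n, ∫⁻ t in Icc D.α D.β, ‖L.b n J t‖ₑ ≤ ENNReal.ofReal B
  bdd_x : ∃ B : ℝ, ∀ n, ∫⁻ ω, ⨆ J ∈ 𝒥 n,
    (∫⁻ t in Icc D.α D.β, ‖L.x n J (D.Z 0 ω) t - D.μ P t‖ₑ) ∂P ≤ ENNReal.ofReal B

/-- The limiting biases are bounded by a constant. -/
def BoundedBias (D : Model Ω E) (P : Measure Ω) (𝒥 : ℕ → Finset ℕ) (L : Limits E) : Prop :=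
  ∃ ϱ : ℝ, 0 < ϱ ∧ ∀ n, ∀ J ∈ 𝒥 n, ∀ i ≤ n, ∀ᵐ ω ∂P, |D.Qstar P L n J i ω - D.Q P i ω| ≤ ϱ

/-- Leaving out a group changes the predictions at its members by `O_p(g)`, uniformly over weights
and groups. The index is `(k, m, w)`; of `w : ℕ → ℝ` only the restriction to `𝒥 n` is used. -/
structure FoldStable (D : Model Ω E) (P : Measure Ω) (A : ℕ → Procedure D.α D.β D.τ)
    (𝒥 : ℕ → Finset ℕ) (K : ℕ → ℕ) (g : ℕ → ℝ) : Prop where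
  rate_nonneg : ∀ n, 0 ≤ g n
  rate_tendsto : Tendsto g atTop (𝓝 0)
  stable : UnifBigOp P
    (fun n => {p : ℕ × ℕ × (ℕ → ℝ) | p.1 < K n ∧ p.2.1 < n / K n ∧
      (fun J : 𝒥 n => p.2.2 J) ∈ stdSimplex ℝ (𝒥 n)})
    (fun n p ω =>
      ‖(A n).predictAvg (fun J : 𝒥 n => p.2.2 J) (D.sample n ω)
          (D.obs n (p.1 * (n / K n) + p.2.1 + 1) ω)
        - (A n).predictAvgOut (fun J : 𝒥 n => p.2.2 J) (n / K n) p.1 (D.sample n ω)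
          (D.obs n (p.1 * (n / K n) + p.2.1 + 1) ω)‖ₑ) g

/-- `η_n` is eventually positive and dominates `n^{1/2}|𝒥|^{1/2}`, `n c_n` and `n g_n`. -/
structure Dominates (D : Model Ω E) (P : Measure Ω) (𝒥 : ℕ → Finset ℕ) (L : Limits E)
    (c g : ℕ → ℝ) : Prop where
  pos : ∀ᶠ n in atTop, 0 < D.η P L 𝒥 n
  models : Tendsto (fun n : ℕ => (D.η P L 𝒥 n)⁻¹ * (√(n : ℝ) * √((𝒥 n).card : ℝ))) atTop (𝓝 0)
  estimation : Tendsto (fun n : ℕ => (D.η P L 𝒥 n)⁻¹ * (n * c n)) atTop (𝓝 0)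
  folds : Tendsto (fun n : ℕ => (D.η P L 𝒥 n)⁻¹ * (n * g n)) atTop (𝓝 0)

end Model

end FLQR

end

/-!
The cross-validation criterion is, up to a term free of the weights, a uniformly good approximation
of a multiple `κ ∈ [1/2, 1]` of the excess prediction error at the limits, `EFPEstar`, and so is the
excess prediction error `EFPE` itself (with `κ = 1`). Hence the minimiser of the criterion minimises
`EFPE` up to an error of order `c + g + n^{-1/2} |𝒥|^{1/2}`, while the minimum of `EFPE` is at least
`η / (2 n)`; the quotient of the two gives the rate (`tight_ratio`).

The approximation has two parts.

* *Plug-in errors.* The check function is `1`-Lipschitz, so losses may be compared through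
  predictions. A prediction `â + ∫ b̂ (X̂ - μ̂)` differs from its limit by `O(c)` times one plus the
  `L¹` norm of the limit curve, which is bounded on average over the sample and in mean at the new
  subject (`tight_predictFrom`, `tight_lintegral_predictFrom`, `tight_sum_envelope`). The integrals
  of products need not converge, but both sides then diverge together. For the new subject,
  Tonelli's theorem is used, which needs the joint measurability of the reconstructed curve in the
  outcome and in time (`measurable_curve`).

* *Empirical process.* The loss at the limits, in excess of that of the true quantile, is a
  Lipschitz function, vanishing at `0`, of the average `∑ J, w J * d J` of bounded biases `d J`.
  The expected maximum of its centred sums over the weights is at most `2 R √(n |𝒥|)` if `|d J| ≤ R`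
  (`integral_iSup_empirical_le`). Observations are removed one at a time: conditionally on the
  others, symmetrisation and contraction replace the centred excess loss by `± 2 ∑ J, w J * d J`
  with a random sign (`integral_iSup_centered_le`), that is, they shift the vector `v` of a linear
  term `∑ J, w J * v J` by `± 2 d`; by the parallelogram law and the concavity of the square root
  this raises the bound `√(‖v‖² + …)` by at most `4 |𝒥| R²` under the root.
-/

namespace FLQR

/-! ### The check function -/

lemma check_eq_max {τ : ℝ} (e : ℝ) : check τ e = max (τ * e) ((τ - 1) * e) := by
  unfold check
  split_ifs with h
  · rw [max_eq_right]; nlinarith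
  · rw [max_eq_left] <;> nlinarith

lemma check_nonneg {τ : ℝ} (hτ : τ ∈ Ioo (0 : ℝ) 1) (e : ℝ) : 0 ≤ check τ e := by
  rw [check_eq_max]
  rcases le_total 0 e with h | h
  · exact le_max_of_le_left (mul_nonneg hτ.1.le h)
  · exact le_max_of_le_right (mul_nonneg_of_nonpos_of_nonpos (by linarith [hτ.2]) h)

lemma abs_check_sub_le {τ : ℝ} (hτ : τ ∈ Ioo (0 : ℝ) 1) (x y : ℝ) :
    |check τ x - check τ y| ≤ |x - y| := by
  rw [check_eq_max, check_eq_max]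
  refine (abs_max_sub_max_le_max _ _ _ _).trans (max_le ?_ ?_)
  · rw [← mul_sub, abs_mul, abs_of_pos hτ.1]
    exact mul_le_of_le_one_left (abs_nonneg _) hτ.2.le
  · rw [← mul_sub, abs_mul]
    refine mul_le_of_le_one_left (abs_nonneg _) (abs_le.2 ⟨?_, ?_⟩) <;> linarith [hτ.1, hτ.2]

lemma check_zero (τ : ℝ) : check τ 0 = 0 := by simp [check]

lemma continuous_check (τ : ℝ) : Continuous (check τ) := by
  have : check τ = fun e => max (τ * e) ((τ - 1) * e) := funext check_eq_max
  rw [this]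
  fun_prop

/-! ### A maximal inequality for Lipschitz functions of linear forms -/

section Empirical

lemma le_iSup_of_finite {W : Type*} [Finite W] (f : W → ℝ) (a : W) : f a ≤ ⨆ a, f a :=
  le_ciSup (Set.finite_range f).bddAbove a

variable {W : Type*} [Finite W] [Nonempty W]

lemma iSup_add_le (f g : W → ℝ) : ⨆ a, (f a + g a) ≤ (⨆ a, f a) + ⨆ a, g a :=
  ciSup_le fun a => add_le_add (le_iSup_of_finite f a) (le_iSup_of_finite g a)

/-- The contraction step: the sum over both signs of the maximum of a perturbed function grows when
the perturbation `f` is replaced by one with larger increments. -/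
lemma iSup_add_iSup_sub_le (A f h : W → ℝ) (hfh : ∀ a b, |f a - f b| ≤ |h a - h b|) :
    (⨆ a, (A a + f a)) + ⨆ a, (A a - f a) ≤ (⨆ a, (A a + h a)) + ⨆ a, (A a - h a) := by
  obtain ⟨a, ha⟩ := exists_eq_ciSup_of_finite (f := fun a => A a + f a)
  obtain ⟨b, hb⟩ := exists_eq_ciSup_of_finite (f := fun a => A a - f a)
  rw [← ha, ← hb]
  have h1 : A a + h a ≤ ⨆ a, (A a + h a) := le_iSup_of_finite (fun a => A a + h a) a
  have h2 : A b + h b ≤ ⨆ a, (A a + h a) := le_iSup_of_finite (fun a => A a + h a) b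
  have h3 : A a - h a ≤ ⨆ a, (A a - h a) := le_iSup_of_finite (fun a => A a - h a) a
  have h4 : A b - h b ≤ ⨆ a, (A a - h a) := le_iSup_of_finite (fun a => A a - h a) b
  have h5 := (le_abs_self _).trans (hfh a b)
  rcases abs_cases (h a - h b) with h6 | h6 <;> linarith

lemma abs_iSup_le {f : W → ℝ} {R : ℝ} (h : ∀ a, |f a| ≤ R) : |⨆ a, f a| ≤ R := by
  obtain ⟨a, ha⟩ := exists_eq_ciSup_of_finite (f := f)
  rw [← ha]
  exact h a

lemma integrable_iSup {α : Type*} [MeasurableSpace α] {μ : Measure α} [IsFiniteMeasure μ]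
    {f : W → α → ℝ} (hf : ∀ a, Measurable (f a)) {R : ℝ} (hR : ∀ a x, |f a x| ≤ R) :
    Integrable (fun x => ⨆ a, f a x) μ :=
  Integrable.of_bound (Measurable.iSup hf).aestronglyMeasurable R
    (ae_of_all _ fun x => abs_iSup_le fun a => hR a x)

variable {E : Type*} [MeasurableSpace E]

/-- Symmetrisation and contraction in one variable: on average over `z`, the centred increment
`f a z - ∫ f a` raises a maximum no more than the increment `2 h a z` with a random sign. -/
lemma integral_iSup_centered_le {ν : Measure E} [IsProbabilityMeasure ν] {f h : W → E → ℝ}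
    (hf : ∀ a, Measurable (f a)) (hh : ∀ a, Measurable (h a)) {R : ℝ}
    (hfR : ∀ a z, |f a z| ≤ R) (hhR : ∀ a z, |h a z| ≤ R)
    (hfh : ∀ a b z, |f a z - f b z| ≤ |h a z - h b z|) (A : W → ℝ) :
    ∫ z, ⨆ a, (A a + (f a z - ∫ z, f a z ∂ν)) ∂ν ≤
      ∫ z, ((⨆ a, (A a + 2 * h a z)) + ⨆ a, (A a - 2 * h a z)) / 2 ∂ν := by
  obtain ⟨S, hS⟩ : ∃ S, ∀ a, |A a| ≤ S :=
    ⟨⨆ a, |A a|, fun a => le_iSup_of_finite (fun a => |A a|) a⟩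
  have hfi (a) : Integrable (f a) ν :=
    Integrable.of_bound (hf a).aestronglyMeasurable R (ae_of_all _ fun z => hfR a z)
  have hfc (a) : |∫ z, f a z ∂ν| ≤ R := by
    simpa using norm_integral_le_of_norm_le_const (μ := ν) (f := f a) (ae_of_all _ (hfR a))
  have b1 (a z) := abs_le.1 (hfR a z)
  have b2 (a z) := abs_le.1 (hhR a z)
  have b3 (a) := abs_le.1 (hS a)
  have b4 (a) := abs_le.1 (hfc a)
  have i1 : Integrable (fun z => ⨆ a, (A a / 2 + f a z)) ν :=
    integrable_iSup (fun a => by fun_prop) (R := S + R) fun a z =>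
      abs_le.2 ⟨by linarith [b1 a z, b3 a], by linarith [b1 a z, b3 a]⟩
  have i2 : Integrable (fun z => ⨆ a, (A a / 2 - f a z)) ν :=
    integrable_iSup (fun a => by fun_prop) (R := S + R) fun a z =>
      abs_le.2 ⟨by linarith [b1 a z, b3 a], by linarith [b1 a z, b3 a]⟩
  have i3 : Integrable (fun z => ⨆ a, (A a + (f a z - ∫ z, f a z ∂ν))) ν :=
    integrable_iSup (fun a => by fun_prop) (R := S + 2 * R) fun a z =>
      abs_le.2 ⟨by linarith [b1 a z, b3 a, b4 a], by linarith [b1 a z, b3 a, b4 a]⟩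
  have i4 : Integrable (fun z => ⨆ a, (A a + 2 * h a z)) ν :=
    integrable_iSup (fun a => by fun_prop) (R := S + 2 * R) fun a z =>
      abs_le.2 ⟨by linarith [b2 a z, b3 a], by linarith [b2 a z, b3 a]⟩
  have i5 : Integrable (fun z => ⨆ a, (A a - 2 * h a z)) ν :=
    integrable_iSup (fun a => by fun_prop) (R := S + 2 * R) fun a z =>
      abs_le.2 ⟨by linarith [b2 a z, b3 a], by linarith [b2 a z, b3 a]⟩
  -- Jensen's inequality: the maximum of the means is at most the mean of the maximum
  have jensen : ⨆ a, (A a / 2 - ∫ z, f a z ∂ν) ≤ ∫ z, ⨆ a, (A a / 2 - f a z) ∂ν := by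
    refine ciSup_le fun a => ?_
    have : A a / 2 - ∫ z, f a z ∂ν = ∫ z, (A a / 2 - f a z) ∂ν := by
      rw [integral_sub (integrable_const _) (hfi a)]; simp
    rw [this]
    exact integral_mono ((integrable_const _).sub (hfi a)) i2
      fun z => le_iSup_of_finite (fun a => A a / 2 - f a z) a
  have half (g : W → ℝ) : ⨆ a, g a / 2 = (⨆ a, g a) / 2 := by
    simp only [div_eq_mul_inv]
    exact (Real.iSup_mul_of_nonneg (by norm_num) g).symm
  calc ∫ z, ⨆ a, (A a + (f a z - ∫ z, f a z ∂ν)) ∂ν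
      ≤ ∫ z, ((⨆ a, (A a / 2 + f a z)) + ∫ z, ⨆ a, (A a / 2 - f a z) ∂ν) ∂ν := by
        refine integral_mono i3 (i1.add (integrable_const _)) fun z => ?_
        refine le_trans ?_ (add_le_add_right jensen _)
        refine le_trans (le_of_eq ?_) (iSup_add_le _ _)
        congr 1; ext a; ring
    _ = ∫ z, ((⨆ a, (A a / 2 + f a z)) + ⨆ a, (A a / 2 - f a z)) ∂ν := by
        rw [integral_add i1 (integrable_const _), integral_add i1 i2]; simp
    _ ≤ ∫ z, ((⨆ a, (A a + 2 * h a z)) + ⨆ a, (A a - 2 * h a z)) / 2 ∂ν := by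
        refine integral_mono (i1.add i2) ((i4.add i5).div_const 2) fun z => ?_
        refine (iSup_add_iSup_sub_le _ _ (fun a => h a z) fun a b => hfh a b z).trans
          (le_of_eq ?_)
        simp only [add_div, ← half]
        congr 1 <;> · congr 1; ext a; ring

variable {Ω ι : Type*} [MeasurableSpace Ω] [Fintype ι]

/-- The expected maximum of a centred empirical process whose increments are dominated by those of
linear forms in bounded vectors. The linear term in `v` makes the bound fit for induction on the
sample: one observation turns `v` into `v ± 2 d z`, whose squared norms have mean
`‖v‖² + 4 ‖d z‖²`. -/
lemma integral_iSup_empirical_le {P : Measure Ω} [IsProbabilityMeasure P] {ν : Measure E}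
    [IsProbabilityMeasure ν] {Z : ℕ → Ω → E} (hZ : ∀ i, Measurable (Z i))
    (hν : ∀ i, P.map (Z i) = ν) (hind : iIndepFun Z P) {w : W → ι → ℝ}
    (hw : ∀ a, ∑ j, |w a j| ≤ 1) {d : E → ι → ℝ} (hd : Measurable d) {R : ℝ}
    (hdR : ∀ z j, |d z j| ≤ R) {f : W → E → ℝ} (hf : ∀ a, Measurable (f a))
    (hfR : ∀ a z, |f a z| ≤ R)
    (hfd : ∀ a b z, |f a z - f b z| ≤ |∑ j, w a j * d z j - ∑ j, w b j * d z j|)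
    (s : Finset ℕ) (v : ι → ℝ) :
    ∫ ω, ⨆ a, (∑ j, w a j * v j + ∑ i ∈ s, (f a (Z i ω) - ∫ z, f a z ∂ν)) ∂P ≤
      √(∑ j, v j ^ 2 + s.card * (4 * (Fintype.card ι * R ^ 2))) := by
  classical
  have lin (a) (u : ι → ℝ) {r : ℝ} (hr : ∀ j, |u j| ≤ r) (hr0 : 0 ≤ r) :
      |∑ j, w a j * u j| ≤ r := by
    calc |∑ j, w a j * u j| ≤ ∑ j, |w a j| * r := by
          refine (Finset.abs_sum_le_sum_abs _ _).trans (Finset.sum_le_sum fun j _ => ?_)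
          rw [abs_mul]
          exact mul_le_mul_of_nonneg_left (hr j) (abs_nonneg _)
      _ ≤ r := by
          rw [← Finset.sum_mul]
          exact mul_le_of_le_one_left hr0 (hw a)
  have hdm (j) : Measurable fun z => d z j := (measurable_pi_iff.1 hd) j
  have hE : Nonempty E := by
    obtain ⟨ω⟩ := nonempty_of_isProbabilityMeasure P
    exact ⟨Z 0 ω⟩
  have hR0 : 0 ≤ R := (abs_nonneg _).trans (hfR (Classical.arbitrary W) hE.some)
  induction s using Finset.induction_on generalizing v with
  | empty =>
    simp only [Finset.sum_empty, add_zero, integral_const, probReal_univ, one_smul,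
      Finset.card_empty, Nat.cast_zero, zero_mul]
    refine ciSup_le fun a => (le_abs_self _).trans (lin a v (fun j => ?_) (Real.sqrt_nonneg _))
    rw [← Real.sqrt_sq_eq_abs]
    exact Real.sqrt_le_sqrt (Finset.single_le_sum (f := fun j => v j ^ 2)
      (fun _ _ => sq_nonneg _) (Finset.mem_univ j))
  | insert i s hi ih =>
    set S : Ω → W → ℝ := fun ω a => ∑ i ∈ s, (f a (Z i ω) - ∫ z, f a z ∂ν) with hS
    have hSm : Measurable S := measurable_pi_iff.2 fun a =>
      Finset.measurable_fun_sum _ fun k _ => ((hf a).comp (hZ k)).sub_const _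
    have hSa (a) : Measurable fun ω => S ω a := (measurable_pi_iff.1 hSm) a
    have hfc (a) : |∫ z, f a z ∂ν| ≤ R := by
      simpa using norm_integral_le_of_norm_le_const (μ := ν) (f := f a) (ae_of_all _ (hfR a))
    have hSR (ω a) : |S ω a| ≤ s.card * (2 * R) := by
      refine (Finset.abs_sum_le_sum_abs _ _).trans ((Finset.sum_le_card_nsmul _ _ (2 * R)
        fun k _ => (abs_sub _ _).trans ?_).trans (by simp))
      linarith [hfR a (Z k ω), hfc a]
    have hSZ : IndepFun S (Z i) P := by
      have h := hind.indepFun_finset s {i} (by simpa using hi) hZ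
      have hψ : Measurable fun y : ({i} : Finset ℕ) → E => y ⟨i, by simp⟩ := measurable_pi_apply _
      have h' := h.comp (φ := fun (y : s → E) a => ∑ k : s, (f a (y k) - ∫ z, f a z ∂ν))
        (by fun_prop) hψ
      have e : (fun (y : s → E) a => ∑ k : s, (f a (y k) - ∫ z, f a z ∂ν)) ∘
          (fun ω (k : s) => Z k ω) = S := by
        ext ω a
        exact Finset.sum_coe_sort s fun k => f a (Z k ω) - ∫ z, f a z ∂ν
      rwa [e] at h'
    obtain ⟨V, hV0, hV⟩ : ∃ V, 0 ≤ V ∧ ∀ j, |v j| ≤ V :=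
      ⟨∑ j, |v j|, Finset.sum_nonneg fun _ _ => abs_nonneg _, fun j =>
        Finset.single_le_sum (f := fun j => |v j|) (fun _ _ => abs_nonneg _) (Finset.mem_univ j)⟩
    have hlin (a) := abs_le.1 (lin a v hV hV0)
    have hld (a z) := abs_le.1 (lin a (d z) (hdR z) hR0)
    have c1 (a z) := abs_le.1 (hfR a z)
    have c2 (a) := abs_le.1 (hfc a)
    have c3 (ω a) := abs_le.1 (hSR ω a)
    set T := V + s.card * (2 * R) + 2 * R with hT
    -- the new observation may be drawn from its law, independently of the others
    have law : ∫ ω, ⨆ a, (∑ j, w a j * v j + ∑ k ∈ insert i s, (f a (Z k ω) - ∫ z, f a z ∂ν)) ∂P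
        = ∫ p, ⨆ a, (∑ j, w a j * v j + S p.1 a + (f a p.2 - ∫ z, f a z ∂ν)) ∂(P.prod ν) := by
      have hH : Measurable fun p : (W → ℝ) × E =>
          ⨆ a, (∑ j, w a j * v j + p.1 a + (f a p.2 - ∫ z, f a z ∂ν)) :=
        Measurable.iSup fun a => by fun_prop
      have h1 : P.map (fun ω => (S ω, Z i ω)) = (P.prod ν).map (Prod.map S id) := by
        rw [(indepFun_iff_map_prod_eq_prod_map_map hSm.aemeasurable (hZ i).aemeasurable).1 hSZ,
          hν i, ← Measure.map_prod_map _ _ hSm measurable_id, Measure.map_id]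
      have h2 := integral_map (hSm.prodMk (hZ i)).aemeasurable hH.aestronglyMeasurable (μ := P)
      have h3 := integral_map (hSm.prodMap measurable_id).aemeasurable hH.aestronglyMeasurable
        (μ := P.prod ν)
      rw [h1] at h2
      refine Eq.trans (integral_congr_ae (ae_of_all _ fun ω => ?_)) (h2.symm.trans h3)
      simp only [Finset.sum_insert hi, hS]
      congr 1; ext a; ring
    have i0 : Integrable (fun p : Ω × E =>
        ⨆ a, (∑ j, w a j * v j + S p.1 a + (f a p.2 - ∫ z, f a z ∂ν))) (P.prod ν) :=
      integrable_iSup (R := T) (fun a => by have := hSa a; fun_prop) fun a p => abs_le.2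
        ⟨by linarith [hlin a, c1 a p.2, c2 a, c3 p.1 a],
          by linarith [hlin a, c1 a p.2, c2 a, c3 p.1 a]⟩
    have i1 : Integrable (fun p : Ω × E =>
        ⨆ a, (∑ j, w a j * v j + S p.1 a + 2 * ∑ j, w a j * d p.2 j)) (P.prod ν) :=
      integrable_iSup (R := T) (fun a => by have := hSa a; fun_prop) fun a p => abs_le.2
        ⟨by linarith [hlin a, hld a p.2, c3 p.1 a], by linarith [hlin a, hld a p.2, c3 p.1 a]⟩
    have i2 : Integrable (fun p : Ω × E =>
        ⨆ a, (∑ j, w a j * v j + S p.1 a - 2 * ∑ j, w a j * d p.2 j)) (P.prod ν) :=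
      integrable_iSup (R := T) (fun a => by have := hSa a; fun_prop) fun a p => abs_le.2
        ⟨by linarith [hlin a, hld a p.2, c3 p.1 a], by linarith [hlin a, hld a p.2, c3 p.1 a]⟩
    have i12 := (i1.add i2).div_const 2
    set B := √(∑ j, v j ^ 2 + (insert i s).card * (4 * (Fintype.card ι * R ^ 2))) with hB
    rw [law, integral_prod _ i0]
    calc ∫ ω, ∫ z, ⨆ a, (∑ j, w a j * v j + S ω a + (f a z - ∫ z, f a z ∂ν)) ∂ν ∂P
        ≤ ∫ ω, ∫ z, ((⨆ a, (∑ j, w a j * v j + S ω a + 2 * ∑ j, w a j * d z j)) +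
            ⨆ a, (∑ j, w a j * v j + S ω a - 2 * ∑ j, w a j * d z j)) / 2 ∂ν ∂P :=
          integral_mono i0.integral_prod_left i12.integral_prod_left fun ω =>
            integral_iSup_centered_le hf (h := fun a z => ∑ j, w a j * d z j)
              (fun a => by fun_prop) hfR (fun a z => lin a (d z) (hdR z) hR0) hfd _
      _ = ∫ z, ∫ ω, ((⨆ a, (∑ j, w a j * v j + S ω a + 2 * ∑ j, w a j * d z j)) +
            ⨆ a, (∑ j, w a j * v j + S ω a - 2 * ∑ j, w a j * d z j)) / 2 ∂P ∂ν :=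
          integral_integral_swap i12
      _ ≤ ∫ _, B ∂ν := by
          refine integral_mono i12.integral_prod_right (integrable_const _) fun z => ?_
          have j1 : Integrable (fun ω =>
              ⨆ a, (∑ j, w a j * v j + S ω a + 2 * ∑ j, w a j * d z j)) P :=
            integrable_iSup (R := T) (fun a => by have := hSa a; fun_prop) fun a ω => abs_le.2
              ⟨by linarith [hlin a, hld a z, c3 ω a], by linarith [hlin a, hld a z, c3 ω a]⟩
          have j2 : Integrable (fun ω =>
              ⨆ a, (∑ j, w a j * v j + S ω a - 2 * ∑ j, w a j * d z j)) P :=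
            integrable_iSup (R := T) (fun a => by have := hSa a; fun_prop) fun a ω => abs_le.2
              ⟨by linarith [hlin a, hld a z, c3 ω a], by linarith [hlin a, hld a z, c3 ω a]⟩
          have k1 := ih fun j => v j + 2 * d z j
          have k2 := ih fun j => v j - 2 * d z j
          simp only
          rw [integral_div, integral_add j1 j2]
          set q := (s.card : ℝ) * (4 * (Fintype.card ι * R ^ 2)) with hq
          have hq0 : 0 ≤ q := by positivity
          have e1 : ∫ ω, ⨆ a, (∑ j, w a j * v j + S ω a + 2 * ∑ j, w a j * d z j) ∂P ≤
              √(∑ j, (v j + 2 * d z j) ^ 2 + q) := by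
            refine le_of_eq_of_le ?_ k1
            congr 1; ext ω; congr 1; ext a
            simp only [mul_add, Finset.sum_add_distrib, Finset.mul_sum, hS]
            rw [add_right_comm]; congr 2
            exact Finset.sum_congr rfl fun j _ => by ring
          have e2 : ∫ ω, ⨆ a, (∑ j, w a j * v j + S ω a - 2 * ∑ j, w a j * d z j) ∂P ≤
              √(∑ j, (v j - 2 * d z j) ^ 2 + q) := by
            refine le_of_eq_of_le ?_ k2
            congr 1; ext ω; congr 1; ext a
            simp only [mul_sub, Finset.sum_sub_distrib, Finset.mul_sum, hS]
            rw [add_sub_right_comm]; congr 2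
            exact Finset.sum_congr rfl fun j _ => by ring
          have hsum : ∑ j, d z j ^ 2 ≤ Fintype.card ι * R ^ 2 := by
            refine (Finset.sum_le_card_nsmul _ _ (R ^ 2) fun j _ => ?_).trans (by simp)
            exact sq_le_sq' (abs_le.1 (hdR z j)).1 (abs_le.1 (hdR z j)).2
          have n1 : 0 ≤ ∑ j, (v j + 2 * d z j) ^ 2 + q := by positivity
          have n2 : 0 ≤ ∑ j, (v j - 2 * d z j) ^ 2 + q := by positivity
          have par : ∑ j, (v j + 2 * d z j) ^ 2 + ∑ j, (v j - 2 * d z j) ^ 2 =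
              2 * ∑ j, v j ^ 2 + 8 * ∑ j, d z j ^ 2 := by
            simp only [Finset.mul_sum, ← Finset.sum_add_distrib]
            exact Finset.sum_congr rfl fun j _ => by ring
          refine (div_le_div_of_nonneg_right (add_le_add e1 e2) zero_le_two).trans ?_
          refine Real.le_sqrt_of_sq_le ?_
          rw [Finset.card_insert_of_notMem hi]
          push_cast
          nlinarith [Real.sq_sqrt n1, Real.sq_sqrt n2,
            sq_nonneg (√(∑ j, (v j + 2 * d z j) ^ 2 + q) - √(∑ j, (v j - 2 * d z j) ^ 2 + q))]
      _ = B := by simp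

end Empirical

section Uniform

variable {Ω E ι : Type*} [MeasurableSpace Ω] [MeasurableSpace E] [Fintype ι]

lemma measurable_sum_mul {d : E → ι → ℝ} (hd : Measurable d) (w : ι → ℝ) :
    Measurable fun z => ∑ j, w j * d z j :=
  Finset.measurable_fun_sum _ fun j _ => ((measurable_pi_iff.1 hd) j).const_mul _

lemma abs_sum_mul_le_of_mem_stdSimplex {w u : ι → ℝ} (hw : w ∈ stdSimplex ℝ ι) {r : ℝ}
    (hu : ∀ j, |u j| ≤ r) : |∑ j, w j * u j| ≤ r := by
  calc |∑ j, w j * u j| ≤ ∑ j, w j * r := by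
        refine (Finset.abs_sum_le_sum_abs _ _).trans (Finset.sum_le_sum fun j _ => ?_)
        rw [abs_mul, abs_of_nonneg (hw.1 j)]
        exact mul_le_mul_of_nonneg_left (hu j) (hw.1 j)
    _ = r := by rw [← Finset.sum_mul, hw.2, one_mul]

/-- The empirical process indexed by the simplex of weights, through Lipschitz functions of convex
combinations of the bounded vector `d`, is of order `√(sample size * number of weights)`. The
simplex is replaced by a finite net, and the zero weight is added to make the maximum nonnegative,
as Markov's inequality requires. -/
lemma measure_exists_stdSimplex_lt_sum {P : Measure Ω} [IsProbabilityMeasure P] {ν : Measure E}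
    [IsProbabilityMeasure ν] {Z : ℕ → Ω → E} (hZ : ∀ i, Measurable (Z i))
    (hν : ∀ i, P.map (Z i) = ν) (hind : iIndepFun Z P) {d : E → ι → ℝ} (hd : Measurable d) {R : ℝ}
    (hdR : ∀ z j, |d z j| ≤ R) {φ : E → ℝ → ℝ} (hφ : Measurable (Function.uncurry φ))
    (hφ0 : ∀ z, φ z 0 = 0) (hφl : ∀ z x y, |φ z x - φ z y| ≤ |x - y|)
    (s : Finset ℕ) {t : ℝ} (ht : 0 < t) :
    P {ω | ∃ w ∈ stdSimplex ℝ ι, 2 * t < ∑ i ∈ s, (φ (Z i ω) (∑ j, w j * d (Z i ω) j) -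
        ∫ z, φ z (∑ j, w j * d z j) ∂ν)} ≤
      ENNReal.ofReal (2 * R * √(s.card * Fintype.card ι) / t) := by
  classical
  rcases isEmpty_or_nonempty ι with hι | ⟨⟨j₀⟩⟩
  · have : {ω | ∃ w ∈ stdSimplex ℝ ι, 2 * t < ∑ i ∈ s, (φ (Z i ω) (∑ j, w j * d (Z i ω) j) -
        ∫ z, φ z (∑ j, w j * d z j) ∂ν)} = ∅ := by
      ext ω
      simp only [mem_ofPred_eq, mem_empty_iff_false, iff_false, not_exists, not_and]
      intro w hw
      simp [stdSimplex] at hw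
    rw [this]; simp
  obtain ⟨ω₀⟩ := nonempty_of_isProbabilityMeasure P
  have hR0 : 0 ≤ R := (abs_nonneg _).trans (hdR (Z 0 ω₀) j₀)
  have hφm (w : ι → ℝ) : Measurable fun z => φ z (∑ j, w j * d z j) :=
    hφ.comp (measurable_id.prodMk (measurable_sum_mul hd w))
  obtain ⟨ε, hε0, hε⟩ : ∃ ε > 0, 2 * s.card * (Fintype.card ι * (ε * R)) ≤ t := by
    refine ⟨t / (2 * s.card * (Fintype.card ι * R) + 1), by positivity, ?_⟩
    have h0 : 0 ≤ 2 * (s.card : ℝ) * (Fintype.card ι * R) := by positivity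
    calc 2 * (s.card : ℝ) * (Fintype.card ι * (t / (2 * s.card * (Fintype.card ι * R) + 1) * R))
        = t * ((2 * s.card * (Fintype.card ι * R)) / (2 * s.card * (Fintype.card ι * R) + 1)) := by
          ring
      _ ≤ t * 1 := mul_le_mul_of_nonneg_left ((div_le_one (by positivity)).2 (by linarith)) ht.le
      _ = t := mul_one t
  obtain ⟨net, hnet, hfin, hcov⟩ := (isCompact_stdSimplex ℝ ι).finite_cover_balls hε0
  let N : Set (ι → ℝ) := insert 0 net
  have : Finite N := hfin.insert 0
  have : Nonempty N := ⟨⟨0, mem_insert _ _⟩⟩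
  have hN1 (a : N) : ∑ j, |a.1 j| ≤ 1 := by
    rcases a.2 with h | h
    · simp [h]
    · have := hnet h
      rw [Finset.sum_congr rfl fun j _ => abs_of_nonneg (this.1 j), this.2]
  have habs (a : N) (z) : |∑ j, a.1 j * d z j| ≤ R := by
    rcases a.2 with h | h
    · simpa [h] using hR0
    · exact abs_sum_mul_le_of_mem_stdSimplex (hnet h) (hdR z)
  have hφb (z) {x : ℝ} (hx : |x| ≤ R) : |φ z x| ≤ R := by
    have := hφl z x 0
    rw [hφ0, sub_zero, sub_zero] at this
    exact this.trans hx
  let f : N → E → ℝ := fun a z => φ z (∑ j, a.1 j * d z j)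
  have hfm (a) : Measurable (f a) := hφm a.1
  have hfR (a z) : |f a z| ≤ R := hφb z (habs a z)
  have hfi (w : ι → ℝ) (hw : w ∈ stdSimplex ℝ ι) :
      Integrable (fun z => φ z (∑ j, w j * d z j)) ν :=
    Integrable.of_bound (hφm w).aestronglyMeasurable R
      (ae_of_all _ fun z => hφb z (abs_sum_mul_le_of_mem_stdSimplex hw (hdR z)))
  have hfc (a) : |∫ z, f a z ∂ν| ≤ R := by
    simpa using norm_integral_le_of_norm_le_const (μ := ν) (f := f a) (ae_of_all _ (hfR a))
  have key := integral_iSup_empirical_le hZ hν hind (w := fun a : N => a.1) hN1 hd hdR hfm hfR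
    (fun a b z => hφl z _ _) s 0
  set G : Ω → ℝ := fun ω => ⨆ a : N, (∑ j, a.1 j * (0 : ι → ℝ) j +
    ∑ i ∈ s, (f a (Z i ω) - ∫ z, f a z ∂ν)) with hG
  have hG0 (ω) : 0 ≤ G ω := by
    refine le_of_eq_of_le ?_ (le_iSup_of_finite _ (⟨0, mem_insert _ _⟩ : N))
    simp [f, hφ0]
  have hGi : Integrable G P := by
    refine integrable_iSup (R := s.card * (2 * R)) (fun a => ?_) fun a ω => ?_
    · exact (Finset.measurable_fun_sum _ fun k _ =>
        ((hfm a).comp (hZ k)).sub_const _).const_add _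
    · simp only [Pi.zero_apply, mul_zero, Finset.sum_const_zero, zero_add]
      refine (Finset.abs_sum_le_sum_abs _ _).trans ((Finset.sum_le_card_nsmul _ _ (2 * R)
        fun k _ => (abs_sub _ _).trans ?_).trans (by simp))
      linarith [hfR a (Z k ω), hfc a]
  have hbound : ∫ ω, G ω ∂P ≤ 2 * R * √(s.card * Fintype.card ι) := by
    refine key.trans (le_of_eq ?_)
    have : ∑ j, (0 : ι → ℝ) j ^ 2 + (s.card : ℝ) * (4 * (Fintype.card ι * R ^ 2)) =
        (2 * R) ^ 2 * (s.card * Fintype.card ι) := by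
      simp; ring
    rw [this, Real.sqrt_mul (by positivity), Real.sqrt_sq (by positivity)]
  have sub : {ω | ∃ w ∈ stdSimplex ℝ ι, 2 * t < ∑ i ∈ s, (φ (Z i ω) (∑ j, w j * d (Z i ω) j) -
        ∫ z, φ z (∑ j, w j * d z j) ∂ν)} ⊆ {ω | t ≤ G ω} := by
    rintro ω ⟨w, hw, hlt⟩
    obtain ⟨w', hw', hdist⟩ : ∃ w' ∈ net, dist w w' < ε := by simpa using hcov hw
    have hd' (z) : |∑ j, w j * d z j - ∑ j, w' j * d z j| ≤ Fintype.card ι * (ε * R) := by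
      rw [← Finset.sum_sub_distrib]
      refine (Finset.abs_sum_le_sum_abs _ _).trans ((Finset.sum_le_card_nsmul _ _ (ε * R)
        fun j _ => ?_).trans (by simp))
      rw [← sub_mul, abs_mul]
      exact mul_le_mul ((dist_le_pi_dist w w' j).trans hdist.le) (hdR z j) (abs_nonneg _) hε0.le
    have h1 (z) : |φ z (∑ j, w j * d z j) - φ z (∑ j, w' j * d z j)| ≤
        Fintype.card ι * (ε * R) := (hφl z _ _).trans (hd' z)
    have h2 : |∫ z, φ z (∑ j, w j * d z j) ∂ν - ∫ z, φ z (∑ j, w' j * d z j) ∂ν| ≤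
        Fintype.card ι * (ε * R) := by
      rw [← integral_sub (hfi w hw) (hfi w' (hnet hw'))]
      simpa using norm_integral_le_of_norm_le_const (μ := ν)
        (f := fun z => φ z (∑ j, w j * d z j) - φ z (∑ j, w' j * d z j)) (ae_of_all _ h1)
    have h3 : ∑ i ∈ s, (φ (Z i ω) (∑ j, w j * d (Z i ω) j) - ∫ z, φ z (∑ j, w j * d z j) ∂ν) ≤
        ∑ i ∈ s, (φ (Z i ω) (∑ j, w' j * d (Z i ω) j) - ∫ z, φ z (∑ j, w' j * d z j) ∂ν) + t := by
      refine le_trans ?_ (add_le_add_right hε _)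
      have : 2 * (s.card : ℝ) * (Fintype.card ι * (ε * R)) =
        ∑ i ∈ s, 2 * (Fintype.card ι * (ε * R)) := by simp; ring
      rw [this, ← Finset.sum_add_distrib]
      refine Finset.sum_le_sum fun i _ => ?_
      have := (abs_le.1 (h1 (Z i ω))).2
      have := (abs_le.1 h2).1
      linarith
    have h4 : ∑ i ∈ s, (φ (Z i ω) (∑ j, w' j * d (Z i ω) j) -
        ∫ z, φ z (∑ j, w' j * d z j) ∂ν) ≤ G ω := by
      refine le_of_eq_of_le ?_ (le_iSup_of_finite _ (⟨w', mem_insert_of_mem _ hw'⟩ : N))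
      simp [f]
    simp only [mem_ofPred_eq]
    linarith
  have markov := mul_meas_ge_le_integral_of_nonneg (ae_of_all _ hG0) hGi t
  calc _ ≤ P {ω | t ≤ G ω} := measure_mono sub
    _ = ENNReal.ofReal (P.real {ω | t ≤ G ω}) := by rw [ofReal_measureReal]
    _ ≤ _ := ENNReal.ofReal_le_ofReal (by rw [le_div_iff₀ ht]; linarith)

end Uniform

/-! ### Measurability of the reconstructed curves -/

lemma measurable_matrix_inv_apply {α : Type*} [MeasurableSpace α] {m : Type*} [Fintype m]
    [DecidableEq m] {M : α → Matrix m m ℝ} (hM : ∀ i j, Measurable fun x => M x i j) (i j : m) :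
    Measurable fun x => (M x)⁻¹ i j := by
  have hM' : Measurable fun x i j => M x i j :=
    measurable_pi_iff.2 fun i => measurable_pi_iff.2 fun j => hM i j
  have cdet : Continuous fun N : m → m → ℝ => (Matrix.of N).det :=
    Continuous.matrix_det continuous_id
  have cadj : Continuous fun N : m → m → ℝ => (Matrix.of N).adjugate i j :=
    (Continuous.matrix_adjugate (A := fun N : m → m → ℝ => Matrix.of N)
      continuous_id).matrix_elem i j
  have hdet : Measurable fun x => (M x).det := cdet.measurable.comp hM'
  have hadj : Measurable fun x => (M x).adjugate i j := cadj.measurable.comp hM'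
  simp only [Matrix.inv_def, Ring.inverse_eq_inv', Matrix.smul_apply, smul_eq_mul]
  exact hdet.inv.mul hadj

namespace Model

variable {Ω E : Type*} [MeasurableSpace Ω] [MeasurableSpace E] {D : Model Ω E} {P : Measure Ω}

lemma IsFLQR.measurable_score (hD : D.IsFLQR P) (F : FPCA D.α D.β) (n i j : ℕ) :
    Measurable fun ω => F.score (D.obs n i ω) j := by
  let h : ℕ → Ω → ℝ := fun m ω => F.score
    ⟨m, fun l => D.T n i l ω, fun l => D.X i ω (D.T n i l ω) + D.e i l ω⟩ j
  have hh (m : ℕ) : Measurable (h m) := by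
    have hT (l) := hD.measurable_T n i l
    have hX (l) : Measurable fun ω => D.X i ω (D.T n i l ω) :=
      hD.measurable_x.comp ((hD.measurable_Z i).prodMk (hT l))
    let M : Ω → Matrix (Fin m) (Fin m) ℝ := fun ω => Matrix.of fun l l' =>
      F.cov (D.T n i l ω) (D.T n i l' ω) + if l = l' then F.noiseVar else 0
    have hM (k k' : Fin m) : Measurable fun ω => M ω k k' := by
      have hc : Measurable fun ω => F.cov (D.T n i k ω) (D.T n i k' ω) :=
        F.measurable_cov.comp ((hT k).prodMk (hT k'))
      exact hc.add_const (if k = k' then F.noiseVar else 0)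
    have hinv (l l' : Fin m) : Measurable fun ω => (M ω)⁻¹ l l' :=
      measurable_matrix_inv_apply hM l l'
    change Measurable fun ω => F.eigval j * ∑ l : Fin m, F.eigfun j (D.T n i l ω) *
      ∑ k : Fin m, (M ω)⁻¹ l k * (D.X i ω (D.T n i k ω) + D.e i k ω - F.mean (D.T n i k ω))
    refine Measurable.const_mul (Finset.measurable_fun_sum _ fun l _ => ?_) _
    refine ((F.measurable_eigfun j).comp (hT l)).mul (Finset.measurable_fun_sum _ fun k _ => ?_)
    exact (hinv l k).mul (((hX k).add (hD.measurable_e i k)).sub (F.measurable_mean.comp (hT k)))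
  have : Measurable fun p : ℕ × Ω => h p.1 p.2 := measurable_from_prod_countable_right hh
  exact this.comp ((hD.measurable_N n i).prodMk measurable_id)

lemma IsFLQR.measurable_curve (hD : D.IsFLQR P) (F : FPCA D.α D.β) (n i J : ℕ) :
    Measurable fun p : Ω × ℝ => F.curve J (D.obs n i p.1) p.2 := by
  refine (F.measurable_mean.comp measurable_snd).add (Finset.measurable_fun_sum _ fun j _ => ?_)
  exact ((hD.measurable_score F n i j).comp measurable_fst).mul
    ((F.measurable_eigfun j).comp measurable_snd)

lemma measurable_slope {α β τ : ℝ} (A : Procedure α β τ) (J : ℕ) (S : Sample) :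
    Measurable (A.slope J S) :=
  Finset.measurable_fun_sum _ fun j _ => ((A.fpca S).measurable_eigfun j).const_mul _

lemma IsFLQR.measurable_predictFrom (hD : D.IsFLQR P) (A : Procedure D.α D.β D.τ) (J : ℕ)
    (S' S : Sample) (n i : ℕ) : Measurable fun ω => A.predictFrom J S' S (D.obs n i ω) := by
  refine Measurable.const_add (StronglyMeasurable.integral_prod_right'
    (f := fun p : Ω × ℝ => A.slope J S' p.2 *
      ((A.fpca S).curve J (D.obs n i p.1) p.2 - (A.fpca S).mean p.2)) ?_).measurable _
  exact (((measurable_slope A J S').comp measurable_snd).mul ((hD.measurable_curve _ n i J).sub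
    ((A.fpca S).measurable_mean.comp measurable_snd))).stronglyMeasurable

lemma IsFLQR.measurable_μ [IsProbabilityMeasure P] (hD : D.IsFLQR P) : Measurable (D.μ P) :=
  (StronglyMeasurable.integral_prod_right' (f := fun p : ℝ × Ω => D.X 0 p.2 p.1)
    (hD.measurable_x.comp (((hD.measurable_Z 0).comp measurable_snd).prodMk
      measurable_fst)).stronglyMeasurable).measurable

/-- `Q_τ(X)` as a function of the record. -/
noncomputable def quantileFun (D : Model Ω E) (P : Measure Ω) (z : E) : ℝ :=
  D.a + ∫ t in Icc D.α D.β, D.b t * (D.x z t - D.μ P t)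

/-- `Q*_{τ,J}(X)` as a function of the record. -/
noncomputable def limitFun (D : Model Ω E) (P : Measure Ω) (L : Limits E) (n J : ℕ) (z : E) : ℝ :=
  L.a n J + ∫ t in Icc D.α D.β, L.b n J t * (L.x n J z t - D.μ P t)

/-- The `L¹` distance of the limit curve from the mean function, maximal over the candidate models,
as a function of the record. -/
noncomputable def envelope (D : Model Ω E) (P : Measure Ω) (𝒥 : ℕ → Finset ℕ) (L : Limits E) (n : ℕ)
    (z : E) : ℝ≥0∞ :=
  ⨆ J ∈ 𝒥 n, ∫⁻ t in Icc D.α D.β, ‖L.x n J z t - D.μ P t‖ₑ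

lemma IsFLQR.measurable_quantileFun [IsProbabilityMeasure P] (hD : D.IsFLQR P) :
    Measurable (D.quantileFun P) := by
  obtain ⟨b, hb, hbe⟩ := hD.slope_memLp.aestronglyMeasurable
  have : D.quantileFun P = fun z => D.a + ∫ t in Icc D.α D.β, b t * (D.x z t - D.μ P t) := by
    ext z
    simp only [quantileFun]
    congr 1
    refine integral_congr_ae ?_
    filter_upwards [hbe] with t ht
    rw [ht]
  rw [this]
  refine Measurable.const_add (StronglyMeasurable.integral_prod_right'
    (f := fun p : E × ℝ => b p.2 * (D.x p.1 p.2 - D.μ P p.2)) ?_).measurable _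
  exact ((hb.measurable.comp measurable_snd).mul (hD.measurable_x.sub
    (hD.measurable_μ.comp measurable_snd))).stronglyMeasurable

lemma measurable_limitFun [IsProbabilityMeasure P] (hD : D.IsFLQR P) {L : Limits E} {n J : ℕ}
    (hb : Measurable (L.b n J)) (hx : Measurable (Function.uncurry (L.x n J))) :
    Measurable (D.limitFun P L n J) := by
  refine Measurable.const_add (StronglyMeasurable.integral_prod_right'
    (f := fun p : E × ℝ => L.b n J p.2 * (L.x n J p.1 p.2 - D.μ P p.2)) ?_).measurable _
  exact ((hb.comp measurable_snd).mul (hx.sub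
    (hD.measurable_μ.comp measurable_snd))).stronglyMeasurable

lemma measurable_envelope [IsProbabilityMeasure P] (hD : D.IsFLQR P) {𝒥 : ℕ → Finset ℕ}
    {L : Limits E} {n : ℕ} (hx : ∀ J ∈ 𝒥 n, Measurable (Function.uncurry (L.x n J))) :
    Measurable (D.envelope P 𝒥 L n) := by
  refine Measurable.iSup fun J => Measurable.iSup fun hJ => Measurable.lintegral_prod_right'
    (f := fun p : E × ℝ => ‖L.x n J p.1 p.2 - D.μ P p.2‖ₑ) ?_
  exact ((hx J hJ).sub (hD.measurable_μ.comp measurable_snd)).enorm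

/-- Records of different subjects are independent. -/
lemma IsFLQR.iIndepFun_Z (hD : D.IsFLQR P) : iIndepFun D.Z P :=
  (hD.indep 0).comp (fun _ p => p.1) fun _ => measurable_fst

lemma IsFLQR.map_Z (hD : D.IsFLQR P) (i : ℕ) : P.map (D.Z i) = P.map (D.Z 0) :=
  (hD.ident i).map_eq

end Model

/-! ### Properties that hold with probability close to one -/

/-- The property `p C n`, which weakens as the constant `C` grows, has probability arbitrarily close
to one for all large `n` if `C` is large enough. -/
def Tight {Ω : Type*} [MeasurableSpace Ω] (P : Measure Ω) (p : ℝ → ℕ → Ω → Prop) : Prop :=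
  ∀ δ : ℝ, 0 < δ → ∃ C : ℝ, 0 < C ∧ ∀ᶠ n in atTop, P {ω | ¬ p C n ω} ≤ ENNReal.ofReal δ

section Tight

variable {Ω : Type*} [MeasurableSpace Ω] {P : Measure Ω} {p q : ℝ → ℕ → Ω → Prop}

lemma unifBigOp_iff_tight {ι : Type*} {I : ℕ → Set ι} {Z : ℕ → ι → Ω → ℝ≥0∞} {r : ℕ → ℝ} :
    UnifBigOp P I Z r ↔ Tight P fun C n ω => ∀ x ∈ I n, Z n x ω ≤ ENNReal.ofReal (C * r n) := by
  simp [UnifBigOp, Tight]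

lemma Tight.imp (hp : Tight P p)
    (h : ∀ C > 0, ∃ C' > 0, ∀ᶠ n in atTop, ∀ᵐ ω ∂P, p C n ω → q C' n ω) : Tight P q := by
  intro δ hδ
  obtain ⟨C, hC, hn⟩ := hp δ hδ
  obtain ⟨C', hC', hn'⟩ := h C hC
  refine ⟨C', hC', ?_⟩
  filter_upwards [hn, hn'] with n h1 h2
  refine (measure_mono_ae ?_).trans h1
  filter_upwards [h2] with ω h3 h4 h5 using h4 (h3 h5)

lemma Tight.and (hp : Tight P p) (hq : Tight P q)
    (mp : ∀ C C' n ω, C ≤ C' → p C n ω → p C' n ω) (mq : ∀ C C' n ω, C ≤ C' → q C n ω → q C' n ω) :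
    Tight P fun C n ω => p C n ω ∧ q C n ω := by
  intro δ hδ
  obtain ⟨C, hC, hn⟩ := hp (δ / 2) (half_pos hδ)
  obtain ⟨C', hC', hn'⟩ := hq (δ / 2) (half_pos hδ)
  refine ⟨max C C', lt_max_of_lt_left hC, ?_⟩
  filter_upwards [hn, hn'] with n h1 h2
  calc P {ω | ¬ (p (max C C') n ω ∧ q (max C C') n ω)}
      ≤ P ({ω | ¬ p C n ω} ∪ {ω | ¬ q C' n ω}) := by
        refine measure_mono fun ω hω => ?_
        by_contra h
        simp only [mem_union, mem_ofPred_eq, not_or, not_not] at h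
        exact hω ⟨mp _ _ _ _ (le_max_left _ _) h.1, mq _ _ _ _ (le_max_right _ _) h.2⟩
    _ ≤ ENNReal.ofReal (δ / 2) + ENNReal.ofReal (δ / 2) :=
        (measure_union_le _ _).trans (add_le_add h1 h2)
    _ = ENNReal.ofReal δ := by
        rw [← ENNReal.ofReal_add (by positivity) (by positivity), add_halves]

/-- Four uniform bounds of the same order hold jointly. -/
lemma UnifBigOp.tight_and {ι₁ ι₂ ι₃ ι₄ : Type*} {I₁ : ℕ → Set ι₁} {I₂ : ℕ → Set ι₂}
    {I₃ : ℕ → Set ι₃} {I₄ : ℕ → Set ι₄} {Z₁ : ℕ → ι₁ → Ω → ℝ≥0∞} {Z₂ : ℕ → ι₂ → Ω → ℝ≥0∞}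
    {Z₃ : ℕ → ι₃ → Ω → ℝ≥0∞} {Z₄ : ℕ → ι₄ → Ω → ℝ≥0∞} {r : ℕ → ℝ} (hr : ∀ n, 0 ≤ r n)
    (h₁ : UnifBigOp P I₁ Z₁ r) (h₂ : UnifBigOp P I₂ Z₂ r) (h₃ : UnifBigOp P I₃ Z₃ r)
    (h₄ : UnifBigOp P I₄ Z₄ r) :
    Tight P fun C n ω =>
      ((∀ x ∈ I₁ n, Z₁ n x ω ≤ ENNReal.ofReal (C * r n)) ∧
        ∀ x ∈ I₂ n, Z₂ n x ω ≤ ENNReal.ofReal (C * r n)) ∧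
      (∀ x ∈ I₃ n, Z₃ n x ω ≤ ENNReal.ofReal (C * r n)) ∧
        ∀ x ∈ I₄ n, Z₄ n x ω ≤ ENNReal.ofReal (C * r n) := by
  have mono {C C' : ℝ} (n : ℕ) (h : C ≤ C') :
      ENNReal.ofReal (C * r n) ≤ ENNReal.ofReal (C' * r n) :=
    ENNReal.ofReal_le_ofReal (mul_le_mul_of_nonneg_right h (hr n))
  exact ((unifBigOp_iff_tight.1 h₁).and (unifBigOp_iff_tight.1 h₂)
    (fun _ _ n _ h h' x hx => (h' x hx).trans (mono n h))
    (fun _ _ n _ h h' x hx => (h' x hx).trans (mono n h))).and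
    ((unifBigOp_iff_tight.1 h₃).and (unifBigOp_iff_tight.1 h₄)
    (fun _ _ n _ h h' x hx => (h' x hx).trans (mono n h))
    (fun _ _ n _ h h' x hx => (h' x hx).trans (mono n h)))
    (fun _ _ n _ h h' => ⟨fun x hx => (h'.1 x hx).trans (mono n h),
      fun x hx => (h'.2 x hx).trans (mono n h)⟩)
    (fun _ _ n _ h h' => ⟨fun x hx => (h'.1 x hx).trans (mono n h),
      fun x hx => (h'.2 x hx).trans (mono n h)⟩)

end Tight

/-! ### Plug-in errors -/

/-- The Bochner integrals of `f` and `g` differ by at most the integral of `‖f - g‖`, even where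
neither is integrable and both have the value `0`. -/
lemma enorm_integral_sub_le {α : Type*} [MeasurableSpace α] {μ : Measure α} {f g : α → ℝ}
    (hf : AEStronglyMeasurable f μ) (hg : AEStronglyMeasurable g μ) :
    ‖∫ x, f x ∂μ - ∫ x, g x ∂μ‖ₑ ≤ ∫⁻ x, ‖f x - g x‖ₑ ∂μ := by
  by_cases h : Integrable (fun x => f x - g x) μ
  · by_cases hg' : Integrable g μ
    · have hf' : Integrable f μ := by
        refine (h.add hg').congr (ae_of_all _ fun x => ?_)
        simp
      rw [← integral_sub hf' hg']
      exact enorm_integral_le_lintegral_enorm _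
    · have hf' : ¬ Integrable f μ := fun hf' =>
        hg' ((hf'.sub h).congr (ae_of_all _ fun x => by simp))
      rw [integral_undef hg', integral_undef hf']
      simp
  · have : ∫⁻ x, ‖f x - g x‖ₑ ∂μ = ∞ := by
      by_contra hne
      exact h ⟨hf.sub hg, lt_of_le_of_ne le_top hne⟩
    rw [this]
    exact le_top

lemma enorm_intercept_add_integral_sub_le {μ : Measure ℝ} {a a' : ℝ} {b b' x x' m m' : ℝ → ℝ}
    (hb : Measurable b) (hb' : Measurable b') (hx : Measurable x) (hx' : Measurable x')
    (hm : Measurable m) (hm' : Measurable m') :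
    ‖(a' + ∫ t, b' t * (x' t - m' t) ∂μ) - (a + ∫ t, b t * (x t - m t) ∂μ)‖ₑ ≤
      ‖a' - a‖ₑ + ((∫⁻ t, ‖b' t - b t‖ₑ * ‖x t - m t‖ₑ ∂μ) +
        ∫⁻ t, (‖b t‖ₑ + ‖b' t - b t‖ₑ) * (‖x' t - x t‖ₑ + ‖m' t - m t‖ₑ) ∂μ) := by
  rw [add_sub_add_comm, ← lintegral_add_left (by fun_prop)]
  refine (enorm_add_le _ _).trans (add_le_add le_rfl ?_)
  refine (enorm_integral_sub_le (by fun_prop) (by fun_prop)).trans (lintegral_mono fun t => ?_)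
  have h1 : b' t * (x' t - m' t) - b t * (x t - m t) =
      (b' t - b t) * (x t - m t) + (b t + (b' t - b t)) * ((x' t - x t) - (m' t - m t)) := by ring
  rw [h1]
  refine (enorm_add_le _ _).trans (add_le_add (enorm_mul _ _).le ?_)
  rw [enorm_mul]
  exact mul_le_mul' (enorm_add_le _ _) enorm_sub_le

lemma lintegral_slope_mul_le {α β : ℝ} {b b' : ℝ → ℝ} (hb : Measurable b) {u : ℝ → ℝ≥0∞}
    {δ B : ℝ≥0∞} (hB : ∫⁻ t in Icc α β, ‖b t‖ₑ ≤ B) (hδ : ∀ t ∈ Icc α β, ‖b' t - b t‖ₑ ≤ δ)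
    (hu : ∀ t ∈ Icc α β, u t ≤ 2 * δ) :
    ∫⁻ t in Icc α β, (‖b t‖ₑ + ‖b' t - b t‖ₑ) * u t ≤
      (B + δ * ENNReal.ofReal (β - α)) * (2 * δ) := by
  calc ∫⁻ t in Icc α β, (‖b t‖ₑ + ‖b' t - b t‖ₑ) * u t
      ≤ ∫⁻ t in Icc α β, (‖b t‖ₑ + δ) * (2 * δ) :=
        setLIntegral_mono' measurableSet_Icc fun t ht =>
          mul_le_mul' (add_le_add le_rfl (hδ t ht)) (hu t ht)
    _ = ((∫⁻ t in Icc α β, ‖b t‖ₑ) + δ * ENNReal.ofReal (β - α)) * (2 * δ) := by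
        rw [lintegral_mul_const _ (by fun_prop), lintegral_add_right _ measurable_const]
        simp
    _ ≤ _ := by gcongr

namespace Model

variable {Ω E : Type*} [MeasurableSpace Ω] [MeasurableSpace E] {D : Model Ω E} {P : Measure Ω}
  [IsProbabilityMeasure P] {A : ℕ → Procedure D.α D.β D.τ} {𝒥 : ℕ → Finset ℕ} {L : Limits E}
  {c : ℕ → ℝ}

omit [MeasurableSpace E] [IsProbabilityMeasure P] in
lemma lintegral_le_envelope {n J : ℕ} (hJ : J ∈ 𝒥 n) (z : E) :
    ∫⁻ t in Icc D.α D.β, ‖L.x n J z t - D.μ P t‖ₑ ≤ D.envelope P 𝒥 L n z :=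
  le_iSup₂ (f := fun J (_ : J ∈ 𝒥 n) => ∫⁻ t in Icc D.α D.β, ‖L.x n J z t - D.μ P t‖ₑ) J hJ

omit [MeasurableSpace E] [IsProbabilityMeasure P] in
lemma lintegral_slope_sub_mul_le {n J : ℕ} (hJ : J ∈ 𝒥 n) (z : E) {b' b : ℝ → ℝ} {δ : ℝ≥0∞}
    (hδ : ∀ t ∈ Icc D.α D.β, ‖b' t - b t‖ₑ ≤ δ) (hδt : δ ≠ ∞) :
    ∫⁻ t in Icc D.α D.β, ‖b' t - b t‖ₑ * ‖L.x n J z t - D.μ P t‖ₑ ≤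
      δ * D.envelope P 𝒥 L n z := by
  refine (setLIntegral_mono' measurableSet_Icc fun t ht => mul_le_mul_left (hδ t ht) _).trans ?_
  rw [lintegral_const_mul' _ _ hδt]
  exact mul_le_mul_right (lintegral_le_envelope hJ z) _

/-- The plug-in error at an in-sample subject: the error of the estimated curve is uniformly small,
that of the slope is multiplied by the size of the limit curve. -/
lemma ConvergesTo.tight_predictFrom (hD : D.IsFLQR P) (h1 : D.ConvergesTo P A 𝒥 L c) :
    Tight P fun C n ω => ∀ J ∈ 𝒥 n, ∀ i ∈ Icc 1 n,
      ‖(A n).predictFrom J (D.sample n ω) (D.sample n ω) (D.obs n i ω) - D.Qstar P L n J i ω‖ₑ ≤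
        ENNReal.ofReal (C * c n) * (1 + D.envelope P 𝒥 L n (D.Z i ω)) := by
  obtain ⟨B, hB⟩ := h1.bdd_b
  have key := h1.intercept.tight_and h1.rate_nonneg h1.slope h1.mean h1.curve
  refine key.imp fun C hC => ?_
  have hΛ : 0 ≤ D.β - D.α := sub_nonneg.2 hD.interval.le
  have hk : 0 < 1 + 2 * (max B 0 + C * (D.β - D.α)) := by positivity
  refine ⟨C * (1 + 2 * (max B 0 + C * (D.β - D.α))), by positivity, ?_⟩
  filter_upwards [h1.rate_tendsto.eventually_le_const one_pos] with n hn
  refine ae_of_all _ fun ω ⟨⟨ha, hb⟩, hm, hx⟩ J hJ i hi => ?_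
  set δ := ENNReal.ofReal (C * c n) with hδ
  have hδC : δ ≤ ENNReal.ofReal C :=
    ENNReal.ofReal_le_ofReal (mul_le_of_le_one_right hC.le hn)
  set S := D.envelope P 𝒥 L n (D.Z i ω) with hS
  have hxm : Measurable (L.x n J (D.Z i ω)) := (h1.measurable_x n J hJ).of_uncurry_left
  have hcm : Measurable (((A n).fpca (D.sample n ω)).curve J (D.obs n i ω)) :=
    (hD.measurable_curve _ n i J).comp (measurable_prodMk_left (x := ω))
  refine (enorm_intercept_add_integral_sub_le (h1.measurable_b n J hJ)
    (measurable_slope _ _ _) hxm hcm hD.measurable_μ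
    ((A n).fpca (D.sample n ω)).measurable_mean).trans ?_
  have e1 := lintegral_slope_sub_mul_le (D := D) (P := P) (L := L) hJ (D.Z i ω)
    (b' := (A n).slope J (D.sample n ω)) (b := L.b n J)
    (fun t ht => hb (J, t) ⟨hJ, ht⟩) ENNReal.ofReal_ne_top
  have e2 := lintegral_slope_mul_le (h1.measurable_b n J hJ) (hB n J hJ)
    (b' := (A n).slope J (D.sample n ω)) (fun t ht => hb (J, t) ⟨hJ, ht⟩)
    (u := fun t => ‖((A n).fpca (D.sample n ω)).curve J (D.obs n i ω) t - L.x n J (D.Z i ω) t‖ₑ +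
      ‖((A n).fpca (D.sample n ω)).mean t - D.μ P t‖ₑ)
    (fun t ht => (add_le_add (hx (i, J, t) ⟨hi, hJ, ht⟩) (hm t ht)).trans (two_mul _).ge)
  calc _ ≤ δ + (δ * S + (ENNReal.ofReal B + δ * ENNReal.ofReal (D.β - D.α)) * (2 * δ)) :=
        add_le_add (ha J hJ) (add_le_add e1 e2)
    _ ≤ δ + (δ * S + (ENNReal.ofReal (max B 0) +
          ENNReal.ofReal C * ENNReal.ofReal (D.β - D.α)) * (2 * δ)) := by
        gcongr; exact le_max_left _ _
    _ = δ * (S + ENNReal.ofReal (1 + 2 * (max B 0 + C * (D.β - D.α)))) := by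
        rw [ENNReal.ofReal_add (by positivity) (by positivity), ENNReal.ofReal_mul (by positivity),
          ENNReal.ofReal_add (by positivity) (by positivity), ENNReal.ofReal_mul (by positivity)]
        simp only [ENNReal.ofReal_one, ENNReal.ofReal_ofNat]
        ring
    _ ≤ δ * (ENNReal.ofReal (1 + 2 * (max B 0 + C * (D.β - D.α))) * (1 + S)) := by
        gcongr δ * ?_
        rw [mul_one_add, add_comm S]
        gcongr
        refine le_mul_of_one_le_left zero_le ?_
        rw [ENNReal.one_le_ofReal]
        have : 0 ≤ max B 0 + C * (D.β - D.α) := by positivity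
        linarith
    _ = _ := by
        rw [← mul_assoc, hδ, ← ENNReal.ofReal_mul (mul_nonneg hC.le (h1.rate_nonneg n))]
        congr 2; ring

/-- The mean plug-in error at the new subject given the sample, by Tonelli's theorem. -/
lemma ConvergesTo.tight_lintegral_predictFrom (hD : D.IsFLQR P) (h1 : D.ConvergesTo P A 𝒥 L c) :
    Tight P fun C n ω => ∀ J ∈ 𝒥 n,
      ∫⁻ ω', ‖(A n).predictFrom J (D.sample n ω) (D.sample n ω) (D.obs n 0 ω') -
        D.Qstar P L n J 0 ω'‖ₑ ∂P ≤ ENNReal.ofReal (C * c n) := by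
  obtain ⟨B, hB⟩ := h1.bdd_b
  obtain ⟨B₁, hB₁⟩ := h1.bdd_x
  have key := h1.intercept.tight_and h1.rate_nonneg h1.slope h1.mean h1.new_curve
  refine key.imp fun C hC => ?_
  have hΛ : 0 ≤ D.β - D.α := sub_nonneg.2 hD.interval.le
  refine ⟨C * (1 + max B₁ 0 + 2 * (max B 0 + C * (D.β - D.α))), by positivity, ?_⟩
  filter_upwards [h1.rate_tendsto.eventually_le_const one_pos] with n hn
  refine ae_of_all _ fun ω ⟨⟨ha, hb⟩, hm, hx⟩ J hJ => ?_
  set δ := ENNReal.ofReal (C * c n) with hδ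
  have hδC : δ ≤ ENNReal.ofReal C :=
    ENNReal.ofReal_le_ofReal (mul_le_of_le_one_right hC.le hn)
  set F := (A n).fpca (D.sample n ω) with hF
  set b' := (A n).slope J (D.sample n ω) with hb'
  have hbm := h1.measurable_b n J hJ
  have hb'm : Measurable b' := measurable_slope _ _ _
  have hxm : Measurable fun p : Ω × ℝ => L.x n J (D.Z 0 p.1) p.2 :=
    (h1.measurable_x n J hJ).comp (((hD.measurable_Z 0).comp measurable_fst).prodMk measurable_snd)
  have hcm : Measurable fun p : Ω × ℝ => F.curve J (D.obs n 0 p.1) p.2 :=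
    hD.measurable_curve _ n 0 J
  have hμ := hD.measurable_μ
  have hmm := F.measurable_mean
  let U : Ω → ℝ → ℝ≥0∞ := fun ω' t => (‖L.b n J t‖ₑ + ‖b' t - L.b n J t‖ₑ) *
    (‖F.curve J (D.obs n 0 ω') t - L.x n J (D.Z 0 ω') t‖ₑ + ‖F.mean t - D.μ P t‖ₑ)
  have hU : Measurable (Function.uncurry U) :=
    ((hbm.comp measurable_snd).enorm.add
      (((hb'm.comp measurable_snd).sub (hbm.comp measurable_snd)).enorm)).mul
    ((hcm.sub hxm).enorm.add ((hmm.comp measurable_snd).sub (hμ.comp measurable_snd)).enorm)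
  have hUm : Measurable fun ω' => ∫⁻ t in Icc D.α D.β, U ω' t := hU.lintegral_prod_right'
  have hSm : Measurable fun ω' => D.envelope P 𝒥 L n (D.Z 0 ω') :=
    (measurable_envelope hD (h1.measurable_x n)).comp (hD.measurable_Z 0)
  have point (ω' : Ω) : ‖(A n).predictFrom J (D.sample n ω) (D.sample n ω) (D.obs n 0 ω') -
      D.Qstar P L n J 0 ω'‖ₑ ≤
        δ + (δ * D.envelope P 𝒥 L n (D.Z 0 ω') + ∫⁻ t in Icc D.α D.β, U ω' t) := by
    have hxm' : Measurable (L.x n J (D.Z 0 ω')) := hxm.comp (measurable_prodMk_left (x := ω'))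
    refine (enorm_intercept_add_integral_sub_le hbm hb'm hxm'
      (hcm.comp (measurable_prodMk_left (x := ω'))) hμ hmm).trans ?_
    exact add_le_add (ha J hJ) (add_le_add (lintegral_slope_sub_mul_le hJ _
      (fun t ht => hb (J, t) ⟨hJ, ht⟩) ENNReal.ofReal_ne_top) le_rfl)
  have tonelli : ∫⁻ ω', (∫⁻ t in Icc D.α D.β, U ω' t) ∂P ≤
      (ENNReal.ofReal B + δ * ENNReal.ofReal (D.β - D.α)) * (2 * δ) := by
    rw [lintegral_lintegral_swap hU.aemeasurable]
    have (t : ℝ) : ∫⁻ ω', U ω' t ∂P = (‖L.b n J t‖ₑ + ‖b' t - L.b n J t‖ₑ) *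
        ((∫⁻ ω', ‖F.curve J (D.obs n 0 ω') t - L.x n J (D.Z 0 ω') t‖ₑ ∂P) +
          ‖F.mean t - D.μ P t‖ₑ) := by
      have hd : Measurable fun ω' => ‖F.curve J (D.obs n 0 ω') t - L.x n J (D.Z 0 ω') t‖ₑ :=
        (hcm.sub hxm).enorm.comp (measurable_prodMk_right (y := t))
      rw [lintegral_const_mul _ (hd.add_const _), lintegral_add_right _ measurable_const]
      simp
    simp only [this]
    exact lintegral_slope_mul_le hbm (hB n J hJ) (fun t ht => hb (J, t) ⟨hJ, ht⟩)
      (fun t ht => (add_le_add (hx (J, t) ⟨hJ, ht⟩) (hm t ht)).trans (two_mul _).ge)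
  calc _ ≤ ∫⁻ ω', (δ + (δ * D.envelope P 𝒥 L n (D.Z 0 ω') + ∫⁻ t in Icc D.α D.β, U ω' t)) ∂P :=
        lintegral_mono point
    _ = δ + (δ * (∫⁻ ω', D.envelope P 𝒥 L n (D.Z 0 ω') ∂P) +
          ∫⁻ ω', (∫⁻ t in Icc D.α D.β, U ω' t) ∂P) := by
        rw [lintegral_add_left measurable_const, lintegral_add_right _ hUm,
          lintegral_const_mul _ hSm]
        simp
    _ ≤ δ + (δ * ENNReal.ofReal (max B₁ 0) + (ENNReal.ofReal (max B 0) +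
          ENNReal.ofReal C * ENNReal.ofReal (D.β - D.α)) * (2 * δ)) := by
        refine add_le_add le_rfl (add_le_add (mul_le_mul_right ((hB₁ n).trans
          (ENNReal.ofReal_le_ofReal (le_max_left _ _))) _) (tonelli.trans ?_))
        gcongr
        exact le_max_left _ _
    _ = δ * ENNReal.ofReal (1 + max B₁ 0 + 2 * (max B 0 + C * (D.β - D.α))) := by
        rw [ENNReal.ofReal_add (by positivity) (by positivity), ENNReal.ofReal_mul (by positivity),
          ENNReal.ofReal_add (by positivity) (by positivity),
          ENNReal.ofReal_add (by positivity) (by positivity), ENNReal.ofReal_mul (by positivity)]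
        simp only [ENNReal.ofReal_one, ENNReal.ofReal_ofNat]
        ring
    _ = _ := by
        rw [hδ, ← ENNReal.ofReal_mul (mul_nonneg hC.le (h1.rate_nonneg n))]
        congr 1; ring

/-- The limit curves of the sample are bounded on average, by Markov's inequality. -/
lemma ConvergesTo.tight_sum_envelope (hD : D.IsFLQR P) (h1 : D.ConvergesTo P A 𝒥 L c) :
    Tight P fun C n ω => ∑ i ∈ Finset.Icc 1 n, D.envelope P 𝒥 L n (D.Z i ω) ≤
      ENNReal.ofReal (C * n) := by
  obtain ⟨B, hB⟩ := h1.bdd_x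
  intro δ hδ
  refine ⟨(max B 0 + 1) / δ, by positivity, ?_⟩
  filter_upwards [eventually_gt_atTop 0] with n hn
  have hn' : (0 : ℝ) < n := Nat.cast_pos.2 hn
  have hm (i) : Measurable fun ω => D.envelope P 𝒥 L n (D.Z i ω) :=
    (measurable_envelope hD (h1.measurable_x n)).comp (hD.measurable_Z i)
  have hint : ∫⁻ ω, ∑ i ∈ Finset.Icc 1 n, D.envelope P 𝒥 L n (D.Z i ω) ∂P ≤
      ENNReal.ofReal (n * (max B 0 + 1)) := by
    rw [lintegral_finsetSum _ fun i _ => hm i]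
    have hi (i : ℕ) : ∫⁻ ω, D.envelope P 𝒥 L n (D.Z i ω) ∂P ≤ ENNReal.ofReal (max B 0 + 1) := by
      refine ((hD.ident i).comp
        (measurable_envelope hD (h1.measurable_x n))).lintegral_eq.trans_le ?_
      exact (hB n).trans (ENNReal.ofReal_le_ofReal ((le_max_left _ _).trans (by linarith)))
    refine (Finset.sum_le_card_nsmul _ _ _ fun i _ => hi i).trans ?_
    rw [ENNReal.ofReal_mul hn'.le]
    simp
  have hC : ENNReal.ofReal ((max B 0 + 1) / δ * n) ≠ 0 := by
    rw [Ne, ENNReal.ofReal_eq_zero, not_le]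
    positivity
  calc P {ω | ¬ ∑ i ∈ Finset.Icc 1 n, D.envelope P 𝒥 L n (D.Z i ω) ≤
          ENNReal.ofReal ((max B 0 + 1) / δ * n)}
      ≤ P {ω | ENNReal.ofReal ((max B 0 + 1) / δ * n) ≤
          ∑ i ∈ Finset.Icc 1 n, D.envelope P 𝒥 L n (D.Z i ω)} :=
        measure_mono fun ω hω => (not_le.1 hω).le
    _ ≤ ENNReal.ofReal (n * (max B 0 + 1)) / ENNReal.ofReal ((max B 0 + 1) / δ * n) :=
        (meas_ge_le_lintegral_div (Finset.measurable_fun_sum _ fun i _ => hm i).aemeasurable hC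
          ENNReal.ofReal_ne_top).trans (ENNReal.div_le_div_right hint _)
    _ = ENNReal.ofReal δ := by
        rw [← ENNReal.ofReal_div_of_pos (by positivity)]
        congr 1
        field_simp

end Model

/-! ### Excess loss at the limits -/

lemma sum_folds {M : Type*} [AddCommMonoid M] (F : ℕ → M) (K m : ℕ) :
    ∑ k ∈ Finset.range K, ∑ j ∈ Finset.range m, F (k * m + j + 1) =
      ∑ i ∈ Finset.Icc 1 (K * m), F i := by
  have shift (N : ℕ) : ∑ i ∈ Finset.Icc 1 N, F i = ∑ i ∈ Finset.range N, F (i + 1) := by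
    induction N with
    | zero => simp
    | succ N ih => rw [Finset.sum_Icc_succ_top (by omega), Finset.sum_range_succ, ih]
  rw [shift]
  induction K with
  | zero => simp
  | succ K ih => rw [Finset.sum_range_succ, ih, Nat.succ_mul, Finset.sum_range_add]

lemma integrable_check {α : Type*} [MeasurableSpace α] {μ : Measure α} {τ : ℝ}
    (hτ : τ ∈ Ioo (0 : ℝ) 1) {f : α → ℝ} (hf : Integrable f μ) :
    Integrable (fun x => check τ (f x)) μ :=
  hf.mono ((continuous_check τ).comp_aestronglyMeasurable hf.1) (ae_of_all _ fun x => by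
    simpa [check_zero] using abs_check_sub_le hτ (f x) 0)

namespace Model

variable {Ω E : Type*} [MeasurableSpace Ω] [MeasurableSpace E] {D : Model Ω E} {P : Measure Ω}
  {A : ℕ → Procedure D.α D.β D.τ} {𝒥 : ℕ → Finset ℕ} {L : Limits E}
  {c g : ℕ → ℝ} {K : ℕ → ℕ}

/-- The limiting bias of model `J` as a function of the record, truncated at `ϱ` so that its bound
holds everywhere and not just almost surely. -/
noncomputable def truncBias (D : Model Ω E) (P : Measure Ω) (L : Limits E) (ϱ : ℝ) (n : ℕ)
    (𝒥 : Finset ℕ) (z : E) (J : 𝒥) : ℝ :=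
  max (-ϱ) (min ϱ (D.limitFun P L n J z - D.quantileFun P z))

/-- The loss of a prediction with bias `u`, in excess of that of the true quantile, as a function of
the record. -/
noncomputable def excessLoss (D : Model Ω E) (P : Measure Ω) (z : E) (u : ℝ) : ℝ :=
  check D.τ (D.y z - D.quantileFun P z - u) - check D.τ (D.y z - D.quantileFun P z)

omit [MeasurableSpace E] in
lemma abs_truncBias_le {ϱ : ℝ} (hϱ : 0 < ϱ) {n : ℕ} {𝒥 : Finset ℕ} (z : E) (J : 𝒥) :
    |D.truncBias P L ϱ n 𝒥 z J| ≤ ϱ :=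
  abs_le.2 ⟨le_max_left _ _, max_le (by linarith) (min_le_left _ _)⟩

omit [MeasurableSpace E] in
/-- `Y_i - ∑_J w_J Q*_{τ,J}(X_i)` is `ε_i` minus the average of the biases. -/
lemma sub_sum_Qstar_eq {n i : ℕ} {ω : Ω} {w : 𝒥 n → ℝ} (hw : w ∈ stdSimplex ℝ (𝒥 n)) :
    D.Y i ω - ∑ J, w J * D.Qstar P L n J i ω =
      D.err P i ω - ∑ J : 𝒥 n, w J * (D.Qstar P L n J i ω - D.Q P i ω) := by
  simp only [mul_sub, Finset.sum_sub_distrib, ← Finset.sum_mul, hw.2, err]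
  ring

omit [MeasurableSpace E] in
lemma excessLoss_eq {n i : ℕ} {ω : Ω} {w : 𝒥 n → ℝ} (hw : w ∈ stdSimplex ℝ (𝒥 n)) {ϱ : ℝ}
    (h : ∀ J ∈ 𝒥 n, |D.Qstar P L n J i ω - D.Q P i ω| ≤ ϱ) :
    D.excessLoss P (D.Z i ω) (∑ J, w J * D.truncBias P L ϱ n (𝒥 n) (D.Z i ω) J) =
      check D.τ (D.Y i ω - ∑ J, w J * D.Qstar P L n J i ω) - check D.τ (D.err P i ω) := by
  have h1 (J : 𝒥 n) : D.truncBias P L ϱ n (𝒥 n) (D.Z i ω) J =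
      D.Qstar P L n J i ω - D.Q P i ω := by
    change max (-ϱ) (min ϱ (D.Qstar P L n J i ω - D.Q P i ω)) = _
    have := abs_le.1 (h J J.2)
    rw [min_eq_right this.2, max_eq_right this.1]
  rw [sub_sum_Qstar_eq hw]
  simp only [h1]
  rfl

variable [IsProbabilityMeasure P]

lemma ConvergesTo.measurable_Qstar (hD : D.IsFLQR P) (h1 : D.ConvergesTo P A 𝒥 L c) {n J : ℕ}
    (hJ : J ∈ 𝒥 n) (i : ℕ) : Measurable (D.Qstar P L n J i) :=
  (measurable_limitFun hD (h1.measurable_b n J hJ) (h1.measurable_x n J hJ)).comp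
    (hD.measurable_Z i)

lemma ConvergesTo.measurable_truncBias (hD : D.IsFLQR P) (h1 : D.ConvergesTo P A 𝒥 L c) (ϱ : ℝ)
    (n : ℕ) : Measurable (D.truncBias P L ϱ n (𝒥 n)) :=
  measurable_pi_iff.2 fun J => measurable_const.max (measurable_const.min
    ((measurable_limitFun hD (h1.measurable_b n J J.2) (h1.measurable_x n J J.2)).sub
      hD.measurable_quantileFun))

lemma IsFLQR.measurable_excessLoss (hD : D.IsFLQR P) :
    Measurable (Function.uncurry (D.excessLoss P)) := by
  have h : Measurable fun p : E × ℝ => D.y p.1 - D.quantileFun P p.1 :=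
    (hD.measurable_y.sub hD.measurable_quantileFun).comp measurable_fst
  exact ((continuous_check D.τ).measurable.comp (h.sub measurable_snd)).sub
    ((continuous_check D.τ).measurable.comp h)

lemma IsFLQR.measurable_excessLoss_comp (hD : D.IsFLQR P) {u : E → ℝ} (hu : Measurable u) :
    Measurable fun z => D.excessLoss P z (u z) := by
  have h : Measurable fun z => D.y z - D.quantileFun P z :=
    hD.measurable_y.sub hD.measurable_quantileFun
  exact ((continuous_check D.τ).measurable.comp (h.sub hu)).sub
    ((continuous_check D.τ).measurable.comp h)

lemma integrable_sub_sum_Qstar (hD : D.IsFLQR P) (h1 : D.ConvergesTo P A 𝒥 L c)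
    (h2 : D.BoundedBias P 𝒥 L) {n : ℕ} {w : 𝒥 n → ℝ} (hw : w ∈ stdSimplex ℝ (𝒥 n)) :
    Integrable (fun ω => D.Y 0 ω - ∑ J, w J * D.Qstar P L n J 0 ω) P := by
  obtain ⟨ϱ, hϱ, hb⟩ := h2
  simp only [sub_sum_Qstar_eq hw]
  refine hD.err_integrable.sub (Integrable.of_bound (C := ϱ) ?_ ?_)
  · refine (Finset.measurable_fun_sum _ fun J _ => Measurable.const_mul
      (Measurable.sub (h1.measurable_Qstar hD J.2 0) ?_) _).aestronglyMeasurable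
    exact hD.measurable_quantileFun.comp (hD.measurable_Z 0)
  · have : ∀ᵐ ω ∂P, ∀ J : 𝒥 n, |D.Qstar P L n J 0 ω - D.Q P 0 ω| ≤ ϱ :=
      ae_all_iff.2 fun J => hb n J J.2 0 (zero_le)
    filter_upwards [this] with ω h
    exact abs_sum_mul_le_of_mem_stdSimplex hw h

lemma EFPEstar_eq_integral_excessLoss (hD : D.IsFLQR P) (h1 : D.ConvergesTo P A 𝒥 L c)
    (h2 : D.BoundedBias P 𝒥 L) {ϱ : ℝ} {n : ℕ}
    (hb : ∀ J ∈ 𝒥 n, ∀ᵐ ω ∂P, |D.Qstar P L n J 0 ω - D.Q P 0 ω| ≤ ϱ)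
    {w : 𝒥 n → ℝ} (hw : w ∈ stdSimplex ℝ (𝒥 n)) :
    D.EFPEstar P L n w = ∫ z, D.excessLoss P z (∑ J, w J * D.truncBias P L ϱ n (𝒥 n) z J)
      ∂(P.map (D.Z 0)) := by
  have hm : Measurable fun z => D.excessLoss P z (∑ J, w J * D.truncBias P L ϱ n (𝒥 n) z J) :=
    hD.measurable_excessLoss_comp (measurable_sum_mul (h1.measurable_truncBias hD ϱ n) w)
  have hae : ∀ᵐ ω ∂P, ∀ J ∈ 𝒥 n, |D.Qstar P L n J 0 ω - D.Q P 0 ω| ≤ ϱ :=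
    ae_all_iff.2 fun J => ae_all_iff.2 fun hJ => hb J hJ
  have hmap := integral_map (hD.measurable_Z 0).aemeasurable (μ := P) hm.aestronglyMeasurable
  refine Eq.trans ?_ hmap.symm
  refine (integral_sub (integrable_check hD.level (integrable_sub_sum_Qstar hD h1 h2 hw))
    (integrable_check hD.level hD.err_integrable)).symm.trans (integral_congr_ae ?_)
  filter_upwards [hae] with ω h
  exact (excessLoss_eq hw h).symm

/-- The sample average of the excess losses at the limits is close to its mean, uniformly over the
weights. -/
lemma BoundedBias.tight_empirical (hD : D.IsFLQR P) (h1 : D.ConvergesTo P A 𝒥 L c)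
    (h2 : D.BoundedBias P 𝒥 L) (h𝒥 : ∀ n, (𝒥 n).Nonempty) {s : ℕ → Finset ℕ}
    (hs : ∀ n, s n ⊆ Finset.Icc 1 n) :
    Tight P fun C n ω => ∀ w ∈ stdSimplex ℝ (𝒥 n),
      |∑ i ∈ s n, (check D.τ (D.Y i ω - ∑ J, w J * D.Qstar P L n J i ω) - check D.τ (D.err P i ω) -
        D.EFPEstar P L n w)| ≤ C * (√(n : ℝ) * √((𝒥 n).card : ℝ)) := by
  have h2' := h2
  obtain ⟨ϱ, hϱ, hb⟩ := h2'
  intro δ hδ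
  -- with this factor, the upper and the lower deviation have probability at most `δ / 2` each
  refine ⟨2 * (4 * ϱ / δ), by positivity, ?_⟩
  filter_upwards [eventually_gt_atTop 0] with n hn
  have hn' : (0 : ℝ) < n := Nat.cast_pos.2 hn
  have hp : (0 : ℝ) < (𝒥 n).card := Nat.cast_pos.2 (h𝒥 n).card_pos
  have hmean (w) (hw : w ∈ stdSimplex ℝ (𝒥 n)) :=
    EFPEstar_eq_integral_excessLoss hD h1 h2 (fun J hJ => hb n J hJ 0 (zero_le)) hw
  have hae : ∀ᵐ ω ∂P, ∀ i ∈ s n, ∀ J ∈ 𝒥 n, |D.Qstar P L n J i ω - D.Q P i ω| ≤ ϱ :=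
    ae_all_iff.2 fun i => ae_all_iff.2 fun hi => ae_all_iff.2 fun J => ae_all_iff.2 fun hJ =>
      hb n J hJ i (Finset.mem_Icc.1 (hs n hi)).2
  set d := D.truncBias P L ϱ n (𝒥 n) with hd
  set ν := P.map (D.Z 0) with hν
  have : IsProbabilityMeasure ν := Measure.isProbabilityMeasure_map (hD.measurable_Z 0).aemeasurable
  set t := 4 * ϱ / δ * (√(n : ℝ) * √((𝒥 n).card : ℝ)) with ht
  have ht0 : 0 < t := by positivity
  have hl (z : E) (x y : ℝ) : |D.excessLoss P z x - D.excessLoss P z y| ≤ |x - y| := by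
    unfold excessLoss
    rw [sub_sub_sub_cancel_right, abs_sub_comm x y]
    refine (abs_check_sub_le hD.level _ _).trans (le_of_eq ?_)
    congr 1; ring
  have h0 (z : E) : D.excessLoss P z 0 = 0 := by simp [excessLoss]
  have up := measure_exists_stdSimplex_lt_sum hD.measurable_Z hD.map_Z hD.iIndepFun_Z
    (h1.measurable_truncBias hD ϱ n) (abs_truncBias_le hϱ) hD.measurable_excessLoss h0 hl (s n) ht0
  have low := measure_exists_stdSimplex_lt_sum hD.measurable_Z hD.map_Z hD.iIndepFun_Z
    (h1.measurable_truncBias hD ϱ n) (abs_truncBias_le hϱ) (φ := fun z x => - D.excessLoss P z x)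
    hD.measurable_excessLoss.neg (fun z => by simp [h0])
    (fun z x y => by rw [neg_sub_neg, abs_sub_comm]; exact hl z x y) (s n) ht0
  have hrate : ENNReal.ofReal (2 * ϱ * √((s n).card * Fintype.card (𝒥 n)) / t) ≤
      ENNReal.ofReal (δ / 2) := by
    refine ENNReal.ofReal_le_ofReal ((div_le_iff₀ ht0).2 ?_)
    have hc : ((s n).card : ℝ) ≤ n := by
      exact_mod_cast (Finset.card_le_card (hs n)).trans (by simp)
    rw [Fintype.card_coe, Real.sqrt_mul (Nat.cast_nonneg _)]
    calc 2 * ϱ * (√((s n).card : ℝ) * √((𝒥 n).card : ℝ))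
        ≤ 2 * ϱ * (√(n : ℝ) * √((𝒥 n).card : ℝ)) := by gcongr
      _ = δ / 2 * t := by rw [ht]; field_simp; ring
  have hsplit : ENNReal.ofReal δ = ENNReal.ofReal (δ / 2) + ENNReal.ofReal (δ / 2) := by
    rw [← ENNReal.ofReal_add (by positivity) (by positivity), add_halves]
  rw [hsplit]
  refine le_trans ?_ (add_le_add (up.trans hrate) (low.trans hrate))
  refine le_trans (measure_mono_ae ?_) (measure_union_le _ _)
  filter_upwards [hae] with ω hω hbad
  obtain ⟨w, hw, hlt⟩ : ∃ w ∈ stdSimplex ℝ (𝒥 n), 2 * (4 * ϱ / δ) * (√(n : ℝ) *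
      √((𝒥 n).card : ℝ)) < |∑ i ∈ s n, (check D.τ (D.Y i ω - ∑ J, w J * D.Qstar P L n J i ω) -
        check D.τ (D.err P i ω) - D.EFPEstar P L n w)| := by
    by_contra! h
    exact hbad h
  have hsum : ∑ i ∈ s n, (check D.τ (D.Y i ω - ∑ J, w J * D.Qstar P L n J i ω) -
      check D.τ (D.err P i ω) - D.EFPEstar P L n w) =
      ∑ i ∈ s n, (D.excessLoss P (D.Z i ω) (∑ J, w J * d (D.Z i ω) J) -
        ∫ z, D.excessLoss P z (∑ J, w J * d z J) ∂ν) :=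
    Finset.sum_congr rfl fun i hi => by rw [hmean w hw, excessLoss_eq hw (hω i hi)]
  rw [hsum, mul_assoc, ← ht] at hlt
  rcases lt_abs.1 hlt with h | h
  · exact Or.inl ⟨w, hw, h⟩
  · refine Or.inr ⟨w, hw, h.trans_eq ?_⟩
    rw [← Finset.sum_neg_distrib]
    refine Finset.sum_congr rfl fun i _ => ?_
    rw [integral_neg]; ring

/-! ### The two prediction errors and the cross-validation criterion -/

omit [MeasurableSpace E] [IsProbabilityMeasure P] in
lemma predictAvg_sub_sum_Qstar {n i : ℕ} {ω ω' : Ω} (w : 𝒥 n → ℝ) :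
    (A n).predictAvg w (D.sample n ω) (D.obs n i ω') - ∑ J, w J * D.Qstar P L n J i ω' =
      ∑ J : 𝒥 n, w J * ((A n).predictFrom J (D.sample n ω) (D.sample n ω) (D.obs n i ω') -
        D.Qstar P L n J i ω') := by
  simp only [Procedure.predictAvg, mul_sub, Finset.sum_sub_distrib]

/-- The prediction error exists and is close to that at the limits, uniformly over the weights. -/
lemma ConvergesTo.tight_EFPE (hD : D.IsFLQR P) (h1 : D.ConvergesTo P A 𝒥 L c)
    (h2 : D.BoundedBias P 𝒥 L) :
    Tight P fun C n ω => ∀ w ∈ stdSimplex ℝ (𝒥 n), Integrable (D.newLoss A n ω w) P ∧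
      |D.EFPE P A n ω w - D.EFPEstar P L n w| ≤ C * c n := by
  refine (h1.tight_lintegral_predictFrom hD).imp fun C hC => ⟨C, hC, Eventually.of_forall fun n =>
    ae_of_all _ fun ω h w hw => ?_⟩
  set H : 𝒥 n → Ω → ℝ := fun J ω' => (A n).predictFrom J (D.sample n ω) (D.sample n ω)
    (D.obs n 0 ω') - D.Qstar P L n J 0 ω' with hH
  have hHm (J : 𝒥 n) : Measurable (H J) :=
    (hD.measurable_predictFrom _ _ _ _ _ _).sub (h1.measurable_Qstar hD J.2 0)
  have hHi (J : 𝒥 n) : Integrable (H J) P :=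
    ⟨(hHm J).aestronglyMeasurable, (h J J.2).trans_lt ENNReal.ofReal_lt_top⟩
  have hHn (J : 𝒥 n) : ∫ ω', ‖H J ω'‖ ∂P ≤ C * c n := by
    rw [integral_norm_eq_lintegral_enorm (hHm J).aestronglyMeasurable]
    exact ENNReal.toReal_le_of_le_ofReal (mul_nonneg hC.le (h1.rate_nonneg n)) (h J J.2)
  have hstar := integrable_sub_sum_Qstar hD h1 h2 hw
  have hsum : Integrable (fun ω' => ∑ J, w J * H J ω') P :=
    integrable_finsetSum _ fun J _ => (hHi J).const_mul _
  have hpred (ω') : D.Y 0 ω' - (A n).predictAvg w (D.sample n ω) (D.obs n 0 ω') =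
      (D.Y 0 ω' - ∑ J, w J * D.Qstar P L n J 0 ω') - ∑ J, w J * H J ω' := by
    rw [hH, ← predictAvg_sub_sum_Qstar]; ring
  have hnew : Integrable (D.newLoss A n ω w) P := by
    unfold newLoss
    simp only [hpred]
    exact integrable_check hD.level (hstar.sub hsum)
  refine ⟨hnew, ?_⟩
  rw [EFPE, EFPEstar, sub_sub_sub_cancel_right,
    ← integral_sub hnew (integrable_check hD.level hstar)]
  calc |∫ ω', (D.newLoss A n ω w ω' - check D.τ (D.Y 0 ω' - ∑ J, w J * D.Qstar P L n J 0 ω')) ∂P|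
      ≤ ∫ ω', ∑ J, w J * ‖H J ω'‖ ∂P := by
        refine (abs_integral_le_integral_abs).trans (integral_mono_of_nonneg
          (ae_of_all _ fun _ => abs_nonneg _)
          (integrable_finsetSum _ fun J _ => (hHi J).norm.const_mul _)
          (ae_of_all _ fun ω' => ?_))
        refine (abs_check_sub_le hD.level _ _).trans ?_
        rw [hpred, sub_sub_cancel_left, abs_neg]
        refine (Finset.abs_sum_le_sum_abs _ _).trans (Finset.sum_le_sum fun J _ => ?_)
        rw [abs_mul, abs_of_nonneg (hw.1 J), Real.norm_eq_abs]
    _ = ∑ J, w J * ∫ ω', ‖H J ω'‖ ∂P := by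
        rw [integral_finsetSum _ fun J _ => (hHi J).norm.const_mul _]
        simp only [integral_const_mul]
    _ ≤ ∑ J, w J * (C * c n) :=
        Finset.sum_le_sum fun J _ => mul_le_mul_of_nonneg_left (hHn J) (hw.1 J)
    _ = C * c n := by rw [← Finset.sum_mul, hw.2, one_mul]

/-- Up to a term that is free of the weights, the criterion is close to a multiple of the prediction
error at the limits. The factor is the fraction of the subjects that are in one of the groups. -/
lemma FoldStable.tight_CV (hD : D.IsFLQR P) (h1 : D.ConvergesTo P A 𝒥 L c)
    (h2 : D.BoundedBias P 𝒥 L) (h𝒥 : ∀ n, (𝒥 n).Nonempty) (h3 : D.FoldStable P A 𝒥 K g) :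
    Tight P fun C n ω => ∀ w ∈ stdSimplex ℝ (𝒥 n),
      |D.CV A K n ω w - 1 / (n : ℝ) * ∑ i ∈ Finset.Icc 1 (K n * (n / K n)),
          check D.τ (D.err P i ω) -
        (K n * (n / K n) : ℕ) / (n : ℝ) * D.EFPEstar P L n w| ≤
      C * (c n + g n + (√(n : ℝ))⁻¹ * √((𝒥 n).card : ℝ)) := by
  have hmono {r : ℝ} (hr : 0 ≤ r) {C C' : ℝ} (h : C ≤ C') :
      ENNReal.ofReal (C * r) ≤ ENNReal.ofReal (C' * r) :=
    ENNReal.ofReal_le_ofReal (mul_le_mul_of_nonneg_right h hr)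
  have hN (n : ℕ) : Finset.Icc 1 (K n * (n / K n)) ⊆ Finset.Icc 1 n :=
    Finset.Icc_subset_Icc le_rfl (Nat.mul_div_le n (K n))
  have key := ((h1.tight_predictFrom hD).and (h1.tight_sum_envelope hD)
    (fun _ _ n _ h h' J hJ i hi => (h' J hJ i hi).trans
      (mul_le_mul' (hmono (h1.rate_nonneg n) h) le_rfl))
    (fun _ _ n _ h h' => h'.trans (hmono (Nat.cast_nonneg n) h))).and
    ((unifBigOp_iff_tight.1 h3.stable).and (h2.tight_empirical hD h1 h𝒥 hN)
    (fun _ _ n _ h h' x hx => (h' x hx).trans (hmono (h3.rate_nonneg n) h))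
    (fun _ _ n _ h h' w hw => (h' w hw).trans (mul_le_mul_of_nonneg_right h (by positivity))))
    (fun _ _ n _ h h' => ⟨fun J hJ i hi => (h'.1 J hJ i hi).trans
      (mul_le_mul' (hmono (h1.rate_nonneg n) h) le_rfl),
      h'.2.trans (hmono (Nat.cast_nonneg n) h)⟩)
    (fun _ _ n _ h h' => ⟨fun x hx => (h'.1 x hx).trans (hmono (h3.rate_nonneg n) h),
      fun w hw => (h'.2 w hw).trans (mul_le_mul_of_nonneg_right h (by positivity))⟩)
  refine key.imp fun C hC => ⟨C + C * C, by positivity, ?_⟩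
  filter_upwards [eventually_gt_atTop 0] with n hn
  refine ae_of_all _ fun ω ⟨⟨hpred, henv⟩, hfold, hemp⟩ w hw => ?_
  have hn' : (0 : ℝ) < n := Nat.cast_pos.2 hn
  have hc := h1.rate_nonneg n
  have hg := h3.rate_nonneg n
  set N := K n * (n / K n) with hNdef
  have hNn : N ≤ n := Nat.mul_div_le n (K n)
  set e : ℕ → ℝ := fun i => (D.envelope P 𝒥 L n (D.Z i ω)).toReal with he
  have hfin (i) (hi : i ∈ Finset.Icc 1 n) : D.envelope P 𝒥 L n (D.Z i ω) ≠ ∞ :=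
    ne_top_of_le_ne_top ENNReal.ofReal_ne_top ((Finset.single_le_sum
      (f := fun i => D.envelope P 𝒥 L n (D.Z i ω)) (fun _ _ => zero_le) hi).trans henv)
  have hesum : ∑ i ∈ Finset.Icc 1 n, e i ≤ C * n := by
    rw [he, ← ENNReal.toReal_sum hfin]
    exact ENNReal.toReal_le_of_le_ofReal (by positivity) henv
  -- replacing a cross-validated prediction by the limit
  have hpoint (k m) (hk : k ∈ Finset.range (K n)) (hm : m ∈ Finset.range (n / K n)) :
      |check D.τ (D.Y (k * (n / K n) + m + 1) ω - (A n).predictAvgOut w (n / K n) k (D.sample n ω)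
          (D.obs n (k * (n / K n) + m + 1) ω)) -
        check D.τ (D.Y (k * (n / K n) + m + 1) ω -
          ∑ J, w J * D.Qstar P L n J (k * (n / K n) + m + 1) ω)| ≤
      C * g n + C * c n * (1 + e (k * (n / K n) + m + 1)) := by
    rw [Finset.mem_range] at hk hm
    have hi : k * (n / K n) + m + 1 ∈ Finset.Icc 1 n := by
      refine Finset.mem_Icc.2 ⟨by omega, le_trans ?_ hNn⟩
      have : (k + 1) * (n / K n) ≤ N := Nat.mul_le_mul_right _ hk
      rw [Nat.succ_mul] at this
      omega
    set i := k * (n / K n) + m + 1 with hidef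
    have f1 : |(A n).predictAvg w (D.sample n ω) (D.obs n i ω) -
        (A n).predictAvgOut w (n / K n) k (D.sample n ω) (D.obs n i ω)| ≤ C * g n := by
      classical
      -- the fold condition is indexed by weights on all of `ℕ`
      have hext : (fun J : 𝒥 n => (fun J : ℕ => if h : J ∈ 𝒥 n then w ⟨J, h⟩ else 0) J) = w := by
        ext J; simp
      have := hfold (k, m, fun J => if h : J ∈ 𝒥 n then w ⟨J, h⟩ else 0)
        ⟨hk, hm, by rw [hext]; exact hw⟩
      simp only [hext] at this
      rw [Real.enorm_eq_ofReal_abs] at this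
      exact (ENNReal.ofReal_le_ofReal_iff (by positivity)).1 this
    have f2 : |(A n).predictAvg w (D.sample n ω) (D.obs n i ω) -
        ∑ J, w J * D.Qstar P L n J i ω| ≤ C * c n * (1 + e i) := by
      rw [predictAvg_sub_sum_Qstar]
      refine abs_sum_mul_le_of_mem_stdSimplex hw fun J => ?_
      have := hpred J J.2 i (Finset.mem_Icc.1 hi)
      have h1e : (1 : ℝ≥0∞) + D.envelope P 𝒥 L n (D.Z i ω) = ENNReal.ofReal (1 + e i) := by
        rw [ENNReal.ofReal_add zero_le_one ENNReal.toReal_nonneg, ENNReal.ofReal_one,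
          ENNReal.ofReal_toReal (hfin i hi)]
      rw [h1e, ← ENNReal.ofReal_mul (by positivity), Real.enorm_eq_ofReal_abs] at this
      exact (ENNReal.ofReal_le_ofReal_iff (mul_nonneg (by positivity)
        (add_nonneg zero_le_one ENNReal.toReal_nonneg))).1 this
    refine (abs_check_sub_le hD.level _ _).trans ?_
    rw [sub_sub_sub_cancel_left]
    have := abs_le.1 f1
    have := abs_le.1 f2
    exact abs_le.2 ⟨by linarith, by linarith⟩
  set b : ℕ → ℝ := fun i => check D.τ (D.Y i ω - ∑ J, w J * D.Qstar P L n J i ω) with hb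
  set S := ∑ k ∈ Finset.range (K n), ∑ m ∈ Finset.range (n / K n),
    check D.τ (D.Y (k * (n / K n) + m + 1) ω - (A n).predictAvgOut w (n / K n) k (D.sample n ω)
      (D.obs n (k * (n / K n) + m + 1) ω)) with hS
  have s1 : |S - ∑ i ∈ Finset.Icc 1 N, b i| ≤ n * (C * g n + C * c n + C * c n * C) := by
    rw [hS, hNdef, ← sum_folds b, ← Finset.sum_sub_distrib]
    calc _ ≤ ∑ k ∈ Finset.range (K n), ∑ m ∈ Finset.range (n / K n),
          (C * g n + C * c n * (1 + e (k * (n / K n) + m + 1))) := by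
          refine (Finset.abs_sum_le_sum_abs _ _).trans (Finset.sum_le_sum fun k hk => ?_)
          rw [← Finset.sum_sub_distrib]
          exact (Finset.abs_sum_le_sum_abs _ _).trans
            (Finset.sum_le_sum fun m hm => hpoint k m hk hm)
      _ = ∑ i ∈ Finset.Icc 1 N, (C * g n + C * c n * (1 + e i)) :=
          sum_folds (fun i => C * g n + C * c n * (1 + e i)) (K n) (n / K n)
      _ ≤ ∑ i ∈ Finset.Icc 1 n, (C * g n + C * c n * (1 + e i)) :=
          Finset.sum_le_sum_of_subset_of_nonneg (hN n) fun i _ _ => by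
            have : 0 ≤ e i := ENNReal.toReal_nonneg
            positivity
      _ = n * (C * g n + C * c n) + C * c n * ∑ i ∈ Finset.Icc 1 n, e i := by
          simp only [Finset.sum_add_distrib, mul_add, ← Finset.mul_sum, Finset.sum_const,
            Nat.card_Icc, Nat.add_sub_cancel, nsmul_eq_mul, mul_one]
          ring
      _ ≤ n * (C * g n + C * c n) + C * c n * (C * n) := by gcongr
      _ = _ := by ring
  have s2 : |∑ i ∈ Finset.Icc 1 N, b i - ∑ i ∈ Finset.Icc 1 N, check D.τ (D.err P i ω) -
      N * D.EFPEstar P L n w| ≤ C * (√(n : ℝ) * √((𝒥 n).card : ℝ)) := by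
    have := hemp w hw
    simpa only [Finset.sum_sub_distrib, Finset.sum_const, Nat.card_Icc, Nat.add_sub_cancel,
      nsmul_eq_mul] using this
  have hCV : D.CV A K n ω w - 1 / (n : ℝ) * ∑ i ∈ Finset.Icc 1 N, check D.τ (D.err P i ω) -
      (N : ℝ) / n * D.EFPEstar P L n w = 1 / (n : ℝ) * ((S - ∑ i ∈ Finset.Icc 1 N, b i) +
        (∑ i ∈ Finset.Icc 1 N, b i - ∑ i ∈ Finset.Icc 1 N, check D.τ (D.err P i ω) -
          N * D.EFPEstar P L n w)) := by
    rw [CV]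
    ring
  rw [hCV, abs_mul, abs_of_pos (by positivity)]
  have hroot : 1 / (n : ℝ) * √(n : ℝ) = (√(n : ℝ))⁻¹ := by
    rw [one_div_mul_eq_div, Real.sqrt_div_self]
  calc _ ≤ 1 / (n : ℝ) * (n * (C * g n + C * c n + C * c n * C) +
          C * (√(n : ℝ) * √((𝒥 n).card : ℝ))) := by
        gcongr
        exact (abs_add_le _ _).trans (add_le_add s1 s2)
    _ = C * (c n + g n + (√(n : ℝ))⁻¹ * √((𝒥 n).card : ℝ)) + C * C * c n := by
        rw [← hroot]
        field_simp
        ring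
    _ ≤ _ := by
        have : 0 ≤ C * C * (g n + (√(n : ℝ))⁻¹ * √((𝒥 n).card : ℝ)) := by positivity
        linarith

end Model

/-! ### Optimality of the cross-validation weights -/

lemma Tight.tendsto_measure {Ω : Type*} [MeasurableSpace Ω] {P : Measure Ω} {q : ℕ → Ω → Prop}
    (h : Tight P fun _ n ω => q n ω) : Tendsto (fun n => P {ω | ¬ q n ω}) atTop (𝓝 0) := by
  rw [ENNReal.tendsto_nhds_zero]
  intro ε hε
  have hmin : min ε 1 ≠ ∞ := ne_top_of_le_ne_top ENNReal.one_ne_top (min_le_right _ _)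
  obtain ⟨C, -, hn⟩ := h (min ε 1).toReal (ENNReal.toReal_pos (by simp [hε.ne']) hmin)
  filter_upwards [hn] with n h'
  rw [ENNReal.ofReal_toReal hmin] at h'
  exact h'.trans (min_le_left _ _)

/-- At least half of the subjects are in one of the groups. -/
lemma half_le_mul_div_div {K n : ℕ} (hK : 2 ≤ K) (hKn : K ≤ n) :
    1 / 2 ≤ ((K * (n / K) : ℕ) : ℝ) / n := by
  have h1 : 1 ≤ n / K := (Nat.one_le_div_iff (by omega)).2 hKn
  have h2 : n < K * (n / K) + K := by
    have := Nat.lt_mul_div_succ n (by omega : 0 < K)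
    rwa [Nat.mul_add, Nat.mul_one] at this
  have h3 : K ≤ K * (n / K) := Nat.le_mul_of_pos_right _ h1
  have h4 : n ≤ 2 * (K * (n / K)) := by omega
  have hn : (0 : ℝ) < n := Nat.cast_pos.2 (by omega)
  rw [div_le_div_iff₀ two_pos hn]
  have : (n : ℝ) ≤ 2 * ((K * (n / K) : ℕ) : ℝ) := by exact_mod_cast h4
  linarith

namespace Model

variable {Ω E : Type*} [MeasurableSpace Ω] [MeasurableSpace E] {D : Model Ω E} {P : Measure Ω}
  [IsProbabilityMeasure P] {A : ℕ → Procedure D.α D.β D.τ} {𝒥 : ℕ → Finset ℕ} {L : Limits E}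
  {c g : ℕ → ℝ} {K : ℕ → ℕ}

omit [IsProbabilityMeasure P] in
lemma bddBelow_range_EFPE (hD : D.IsFLQR P) (n : ℕ) (ω : Ω) :
    BddBelow (range fun w : stdSimplex ℝ (𝒥 n) => D.EFPE P A n ω w.1) := by
  refine ⟨- ∫ ω', check D.τ (D.err P 0 ω') ∂P, ?_⟩
  rintro _ ⟨w, rfl⟩
  have : 0 ≤ ∫ ω', D.newLoss A n ω w.1 ω' ∂P := integral_nonneg fun _ => check_nonneg hD.level _
  simp only [EFPE]
  linarith

omit [IsProbabilityMeasure P] in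
lemma bddBelow_range_EFPEstar (hD : D.IsFLQR P) (n : ℕ) :
    BddBelow (range fun w : stdSimplex ℝ (𝒥 n) => D.EFPEstar P L n w.1) := by
  refine ⟨- ∫ ω', check D.τ (D.err P 0 ω') ∂P, ?_⟩
  rintro _ ⟨w, rfl⟩
  have : 0 ≤ ∫ ω, check D.τ (D.Y 0 ω - ∑ J, w.1 J * D.Qstar P L n J 0 ω) ∂P :=
    integral_nonneg fun _ => check_nonneg hD.level _
  simp only [EFPEstar]
  linarith

/-- A minimiser of a criterion that differs from `κ * F*` by a constant and an error of at most `r`,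
where `1 / 2 ≤ κ`, almost minimises any `F` within `s` of `F*`. -/
lemma le_add_of_approx_minimiser {V : Type*} {S : Set V} {CV F Fstar : V → ℝ} {k κ r s : ℝ}
    (hκ : 1 / 2 ≤ κ) (hCV : ∀ v ∈ S, |CV v - k - κ * Fstar v| ≤ r)
    (hF : ∀ v ∈ S, |F v - Fstar v| ≤ s) {v₀ v : V} (hv₀ : v₀ ∈ S) (hv : v ∈ S)
    (hmin : CV v₀ ≤ CV v) : F v₀ ≤ F v + (4 * r + 2 * s) := by
  have h1 := abs_le.1 (hCV v₀ hv₀)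
  have h2 := abs_le.1 (hCV v hv)
  have h3 := abs_le.1 (hF v₀ hv₀)
  have h4 := abs_le.1 (hF v hv)
  have h5 : κ * (Fstar v₀ - Fstar v) ≤ 2 * r := by linarith
  have hr : 0 ≤ r := (abs_nonneg _).trans (hCV v hv)
  have h6 : Fstar v₀ - Fstar v ≤ 4 * r := by
    by_contra! h
    nlinarith
  linarith

omit [MeasurableSpace E] [IsProbabilityMeasure P] in
lemma Dominates.tendsto_rate (h4 : D.Dominates P 𝒥 L c g) :
    Tendsto (fun n : ℕ => (D.η P L 𝒥 n)⁻¹ * n *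
      (c n + g n + (√(n : ℝ))⁻¹ * √((𝒥 n).card : ℝ))) atTop (𝓝 0) := by
  have h := (h4.estimation.add h4.folds).add h4.models
  simp only [add_zero] at h
  refine h.congr fun n => ?_
  have : (n : ℝ) * (√(n : ℝ))⁻¹ = √(n : ℝ) := by
    rw [← div_eq_mul_inv, Real.div_sqrt]
  linear_combination (-((D.η P L 𝒥 n)⁻¹ * √((𝒥 n).card : ℝ))) * this

/-- The asymptotic optimality of the cross-validation weights, with the events on which it holds
made explicit. -/
lemma tight_ratio (hD : D.IsFLQR P) (h𝒥 : ∀ n, (𝒥 n).Nonempty)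
    (hK : ∀ᶠ n in atTop, 2 ≤ K n ∧ K n ≤ n) (h1 : D.ConvergesTo P A 𝒥 L c)
    (h2 : D.BoundedBias P 𝒥 L) (h3 : D.FoldStable P A 𝒥 K g) (h4 : D.Dominates P 𝒥 L c g)
    {wHat : (n : ℕ) → Ω → 𝒥 n → ℝ} (hw : ∀ n ω, D.IsCVWeight A K n ω (wHat n ω)) :
    Tight P fun C n ω => ((∀ w ∈ stdSimplex ℝ (𝒥 n), Integrable (D.newLoss A n ω w) P) ∧
        0 < D.infEFPE P A 𝒥 n ω) ∧
      |D.EFPE P A n ω (wHat n ω) / D.infEFPE P A 𝒥 n ω - 1| ≤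
        C * ((D.η P L 𝒥 n)⁻¹ * n * (c n + g n + (√(n : ℝ))⁻¹ * √((𝒥 n).card : ℝ))) := by
  have key := (h1.tight_EFPE hD h2).and (h3.tight_CV hD h1 h2 h𝒥)
    (fun _ _ n _ h h' w hw => ⟨(h' w hw).1, (h' w hw).2.trans
      (mul_le_mul_of_nonneg_right h (h1.rate_nonneg n))⟩)
    (fun _ _ n _ h h' w hw => (h' w hw).trans (mul_le_mul_of_nonneg_right h
      (add_nonneg (add_nonneg (h1.rate_nonneg n) (h3.rate_nonneg n)) (by positivity))))
  refine key.imp fun C hC => ⟨12 * C, by positivity, ?_⟩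
  have hsmall := h4.tendsto_rate.const_mul C
  rw [mul_zero] at hsmall
  filter_upwards [hK, h4.pos, hsmall.eventually_le_const (half_pos one_pos),
    eventually_gt_atTop 0] with n hKn hη hrate hn
  refine ae_of_all _ fun ω ⟨hE, hCV⟩ => ?_
  have hn' : (0 : ℝ) < n := Nat.cast_pos.2 hn
  have hc := h1.rate_nonneg n
  have hg := h3.rate_nonneg n
  set r := c n + g n + (√(n : ℝ))⁻¹ * √((𝒥 n).card : ℝ) with hr
  have hcr : c n ≤ r := by
    have : 0 ≤ (√(n : ℝ))⁻¹ * √((𝒥 n).card : ℝ) := by positivity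
    linarith
  have hCcr : C * c n ≤ C * r := mul_le_mul_of_nonneg_left hcr hC.le
  set η := D.η P L 𝒥 n with hηdef
  have hCr : C * r ≤ η / (2 * n) := by
    have : C * r = C * (η⁻¹ * n * r) * (η / n) := by field_simp
    rw [this]
    calc C * (η⁻¹ * n * r) * (η / n) ≤ 1 / 2 * (η / n) := by gcongr
      _ = η / (2 * n) := by field_simp
  obtain ⟨J₀, hJ₀⟩ := h𝒥 n
  have : Nonempty (𝒥 n) := ⟨⟨J₀, hJ₀⟩⟩
  have hstar (w) (hw : w ∈ stdSimplex ℝ (𝒥 n)) : η / n ≤ D.EFPEstar P L n w := by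
    rw [hηdef, Model.η, mul_div_cancel_left₀ _ hn'.ne']
    exact ciInf_le (bddBelow_range_EFPEstar hD n) ⟨w, hw⟩
  have hinf : η / (2 * n) ≤ D.infEFPE P A 𝒥 n ω := by
    refine le_ciInf fun w => ?_
    have e1 := abs_le.1 (hE w.1 w.2).2
    have e2 := hstar w.1 w.2
    have e3 : η / (n : ℝ) = η / (2 * n) + η / (2 * n) := by field_simp; ring
    linarith
  have hpos : 0 < D.infEFPE P A 𝒥 n ω := lt_of_lt_of_le (by positivity) hinf
  have hle : D.infEFPE P A 𝒥 n ω ≤ D.EFPE P A n ω (wHat n ω) :=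
    ciInf_le (bddBelow_range_EFPE hD n ω) ⟨wHat n ω, (hw n ω).1⟩
  have hge : D.EFPE P A n ω (wHat n ω) ≤ D.infEFPE P A 𝒥 n ω + 6 * (C * r) := by
    rw [← sub_le_iff_le_add]
    refine le_ciInf fun w => ?_
    have := le_add_of_approx_minimiser (half_le_mul_div_div hKn.1 hKn.2) hCV
      (fun v hv => (hE v hv).2) (hw n ω).1 w.2 ((hw n ω).2 w.1 w.2)
    linarith
  refine ⟨⟨fun w hw => (hE w hw).1, hpos⟩, ?_⟩
  have hratio : D.EFPE P A n ω (wHat n ω) / D.infEFPE P A 𝒥 n ω - 1 =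
      (D.EFPE P A n ω (wHat n ω) - D.infEFPE P A 𝒥 n ω) / D.infEFPE P A 𝒥 n ω := by
    field_simp
  rw [hratio, abs_of_nonneg (div_nonneg (sub_nonneg.2 hle) hpos.le)]
  have hr0 : 0 ≤ C * r := mul_nonneg hC.le (hc.trans hcr)
  calc _ ≤ 6 * (C * r) / (η / (2 * n)) :=
        div_le_div₀ (by positivity) (by linarith) (by positivity) hinf
    _ = 12 * C * (η⁻¹ * n * r) := by field_simp; ring

end Model

end FLQR

theorem theorem1 {Ω E : Type*} [MeasurableSpace Ω] [MeasurableSpace E]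
    (P : Measure Ω) [IsProbabilityMeasure P]
    (D : FLQR.Model Ω E) (hD : D.IsFLQR P)
    (A : ℕ → FLQR.Procedure D.α D.β D.τ)
    (𝒥 : ℕ → Finset ℕ) (h𝒥 : ∀ n, (𝒥 n).Nonempty)
    (K : ℕ → ℕ) (hK : ∀ᶠ n in atTop, 2 ≤ K n ∧ K n ≤ n)
    (L : FLQR.Limits E) (c g : ℕ → ℝ)
    (h1 : D.ConvergesTo P A 𝒥 L c) (h2 : D.BoundedBias P 𝒥 L)
    (h3 : D.FoldStable P A 𝒥 K g) (h4 : D.Dominates P 𝒥 L c g)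
    (wHat : (n : ℕ) → Ω → 𝒥 n → ℝ) (hw : ∀ n ω, D.IsCVWeight A K n ω (wHat n ω)) :
    -- with probability tending to one, the prediction errors are finite and the infimum is positive
    Tendsto (fun n => P {ω | ¬ ((∀ w ∈ stdSimplex ℝ (𝒥 n), Integrable (D.newLoss A n ω w) P) ∧
        0 < D.infEFPE P A 𝒥 n ω)}) atTop (𝓝 0) ∧
    -- the ratio is `1 + O_p(η⁻¹ n (c + g + n^{-1/2} |𝒥|^{1/2}))`
    FLQR.UnifBigOp P (fun _ => (Set.univ : Set Unit))
      (fun n _ ω => ‖D.EFPE P A n ω (wHat n ω) / D.infEFPE P A 𝒥 n ω - 1‖ₑ)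
      (fun n => (D.η P L 𝒥 n)⁻¹ * n * (c n + g n + (√(n : ℝ))⁻¹ * √((𝒥 n).card : ℝ))) ∧
    -- the ratio is `1 + o_p(1)`
    TendstoInMeasure P (fun n ω => D.EFPE P A n ω (wHat n ω) / D.infEFPE P A 𝒥 n ω)
      atTop (fun _ => 1) := by
  have main := FLQR.Model.tight_ratio hD h𝒥 hK h1 h2 h3 h4 hw
  refine ⟨?_, ?_, fun ε hε => ?_⟩
  · exact (main.imp fun C hC => ⟨C, hC, Eventually.of_forall fun n =>
      ae_of_all _ fun ω h => h.1⟩).tendsto_measure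
  · refine FLQR.unifBigOp_iff_tight.2 (main.imp fun C hC => ⟨C, hC, Eventually.of_forall fun n =>
      ae_of_all _ fun ω h _ _ => ?_⟩)
    rw [Real.enorm_eq_ofReal_abs]
    exact ENNReal.ofReal_le_ofReal h.2
  · have hlim : FLQR.Tight P fun _ n ω =>
        ¬ ε ≤ edist (D.EFPE P A n ω (wHat n ω) / D.infEFPE P A 𝒥 n ω) 1 := by
      refine main.imp fun C hC => ⟨C, hC, ?_⟩
      have hsmall := ENNReal.tendsto_ofReal (h4.tendsto_rate.const_mul C)
      rw [mul_zero, ENNReal.ofReal_zero] at hsmall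
      filter_upwards [hsmall.eventually_lt_const hε] with n hn
      refine ae_of_all _ fun ω h => not_le.2 (lt_of_le_of_lt ?_ hn)
      rw [edist_dist, Real.dist_eq]
      exact ENNReal.ofReal_le_ofReal h.2
    simpa only [not_not] using hlim.tendsto_measure
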